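/- **Setting.** Let $\Omega\subset\mathbb R^n$ be a bounded domain, partitioned into a finite collection $\mathcal T_h$ of non-overlapping open cells $K$ whose boundaries consist of finitely many flat facets $e$ (for instance a simplicial triangulation); every facet is either contained in $\partial\Omega$ and belongs to one cell, or is interior and shared by exactly two cells. Fix a polynomial degree $r\ge 0$ and a form degree $k\ge 0$ (forms of degree $<0$ or $>n$ are zero). Put $$W_h^j=\prod_{K\in\mathcal T_h}\mathcal P_r\Lambda^j(K),\qquad L^2\Lambda^j(\partial\mathcal T_h)=\prod_{K}\prod_{e\subset\partial K}L^2\Lambda^j(e),$$ where $\mathcal P_r\Lambda^j$ denotes differential $j$-forms with polynomial coefficients of degree at most $r$. Let $\widehat V_h^{j,\mathrm{tan}}$ be the set of $\widehat w\in\prod_K\prod_{e\subset\partial K}\mathcal P_r\Lambda^j(e)$ whose values from the two sides of every interior facet agree, and $\mathring{\widehat V}{}_h^{j,\mathrm{tan}}$ the subspace of those that vanish on $\partial\Omega$. Let $(\cdot,\cdot)_{\mathcal T_h}$ and $\langle\cdot,\cdot\rangle_{\partial\mathcal T_h}$ be the $L^2$ inner products of forms on the cells and on the cell boundaries, $\delta=(-1)^k\star^{-1}\mathrm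 d\star$ the (cellwise) codifferential, $w^{\mathrm{tan}}=\operatorname{tr}w$ the tangential trace and $w^{\mathrm{nor}}=\widehat\star^{-1}\operatorname{tr}\star w$ the normal trace on $\partial K$. Let $\alpha^{k-1}$ and $\alpha^k$ be bounded symmetric operators on $L^2\Lambda^{k-1}(\partial\mathcal T_h)$ and $L^2\Lambda^k(\partial\mathcal T_h)$ (for example, multiplication by a constant on each facet of each cell). **Theorem.** Suppose that $\alpha^{k-1}$ is negative-definite and $\alpha^k$ is positive-definite. (1) For all $u_h\in W_h^k$ and all boundary data (the values on $\partial\Omega$ of given elements of $\widehat V_h^{k-1,\mathrm{tan}}$ and $\widehat V_h^{k,\mathrm{tan}}$), there exist unique $\sigma_h\in W_h^{k-1}$, $\rho_h\in W_h^{k+1}$, $\widehat\sigma_h^{\mathrm{tan}}\in\widehat V_h^{k-1,\mathrm{tan}}$ and $\widehat u_h^{\mathrm{tan}}\in\widehat V_h^{k,\mathrm{tan}}$ such that $\widehat\sigma_h^{\mathrm{tan}}$ and $\widehat u_h^{\mathrm{tan}}$ take the given values on $\partial\Omega$ (so that only their interior parts are unknown), the constraints $$(\delta u_h,\tau_h)_{\mathcal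 T_h}+\langle\alpha^{k-1}(\widehat\sigma_h^{\mathrm{tan}}-\sigma_h^{\mathrm{tan}}),\tau_h^{\mathrm{tan}}\rangle_{\partial\mathcal T_h}=-(\sigma_h,\tau_h)_{\mathcal T_h}\quad\forall\tau_h\in W_h^{k-1},$$ $$(u_h,\delta\eta_h)_{\mathcal T_h}+\langle\widehat u_h^{\mathrm{tan}},\eta_h^{\mathrm{nor}}\rangle_{\partial\mathcal T_h}=-(\rho_h,\eta_h)_{\mathcal T_h}\quad\forall\eta_h\in W_h^{k+1}$$ hold, and the conservativity conditions $$\langle u_h^{\mathrm{nor}}-\alpha^{k-1}(\widehat\sigma_h^{\mathrm{tan}}-\sigma_h^{\mathrm{tan}}),\widehat\tau_h\rangle_{\partial\mathcal T_h}=0\quad\forall\widehat\tau_h\in\mathring{\widehat V}{}_h^{k-1,\mathrm{tan}},$$ $$\langle\rho_h^{\mathrm{nor}}-\alpha^{k}(\widehat u_h^{\mathrm{tan}}-u_h^{\mathrm{tan}}),\widehat v_h\rangle_{\partial\mathcal T_h}=0\quad\forall\widehat v_h\in\mathring{\widehat V}{}_h^{k,\mathrm{tan}}$$ hold. (2) Hence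 the dynamics of $(u_h,p_h)\in W_h^k\times W_h^k$ are well-defined. Let $I\subset\mathbb R$, let $f\colon I\times W_h^k\to L^2\Lambda^k(\Omega)$, and let boundary data be given for each $t\in I$. Then for all $t\in I$ and $u_h,p_h\in W_h^k$, with $\sigma_h,\rho_h,\widehat\sigma_h^{\mathrm{tan}},\widehat u_h^{\mathrm{tan}}$ as in (1), there are unique $\dot u_h,\dot p_h\in W_h^k$ with $$(\dot u_h,r_h)_{\mathcal T_h}=(p_h,r_h)_{\mathcal T_h}\quad\forall r_h\in W_h^k,$$ $$-(\dot p_h,v_h)_{\mathcal T_h}+(\sigma_h,\delta v_h)_{\mathcal T_h}+(\delta\rho_h,v_h)_{\mathcal T_h}+\langle\widehat\sigma_h^{\mathrm{tan}},v_h^{\mathrm{nor}}\rangle_{\partial\mathcal T_h}+\langle\alpha^k(\widehat u_h^{\mathrm{tan}}-u_h^{\mathrm{tan}}),v_h^{\mathrm{tan}}\rangle_{\partial\mathcal T_h}=(f(t,u_h),v_h)_{\mathcal T_h}\quad\forall v_h\in W_h^k.$$ (3) If moreover $I$ is an interval, $f$ is continuous with a continuous derivative in $u_h$, and the boundary data (extended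 by zero or in any other continuous way to $\widehat V_h^{k-1,\mathrm{tan}}$, $\widehat V_h^{k,\mathrm{tan}}$) depend continuously on $t$, then for all $t_0\in I$ and $u_0,p_0\in W_h^k$ the resulting system with $u_h(t_0)=u_0$, $p_h(t_0)=p_0$ has a solution on $I\cap[t_0-\varepsilon,t_0+\varepsilon]$ for some $\varepsilon>0$, and any two solutions on an interval $J$ with $t_0\in J\subset I$ coincide. -/

import Mathlib

open MeasureTheory Set Filter Topology
open scoped BigOperators

noncomputable section

/-! ## Exterior algebra -/

/-- `Alt V = ⨁_{k = 0}^{n} Alt^k V`: a family whose `k`-th member is an alternating `k`-linear form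
on `V`.  It is used for `V = ℝⁿ` and for the tangent spaces of the facets. -/
abbrev AltForm (n : ℕ) (V : Type*) [NormedAddCommGroup V] [NormedSpace ℝ V] : Type _ :=
  (k : Fin (n + 1)) → V [⋀^Fin (k : ℕ)]→L[ℝ] ℝ

/-- The homogeneous part `Alt^j V` of `Alt V`, for an integer degree `j`; it is zero for `j < 0` and
for `j > n`. -/
def altDeg (n : ℕ) (V : Type*) [NormedAddCommGroup V] [NormedSpace ℝ V] (j : ℤ) :
    Submodule ℝ (AltForm n V) where
  carrier := {w | ∀ k : Fin (n + 1), ((k : ℕ) : ℤ) ≠ j → w k = 0}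
  add_mem' := by
    intro a b ha hb k hk
    simp [ha k hk, hb k hk]
  zero_mem' := by
    intro k _
    rfl
  smul_mem' := by
    intro c a ha k hk
    simp [ha k hk]

/-- The inner product on `Alt V` induced by the inner product of `V`: with an orthonormal basis
`b₁, …, b_d` it is `∑_k ∑_{i₁ < ⋯ < i_k} v(b_{i₁}, …, b_{i_k}) w(b_{i₁}, …, b_{i_k})`, where the sum
over increasing multi-indices is written as `1 / k!` times the sum over all multi-indices. -/
def altInner {n : ℕ} {V : Type*} [NormedAddCommGroup V] [InnerProductSpace ℝ V]
    [FiniteDimensional ℝ V] (v w : AltForm n V) : ℝ :=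
  ∑ k : Fin (n + 1), ((Nat.factorial (k : ℕ) : ℝ))⁻¹ *
    ∑ i : Fin (k : ℕ) → Fin (Module.finrank ℝ V),
      v k (fun a => stdOrthonormalBasis ℝ V (i a)) * w k (fun a => stdOrthonormalBasis ℝ V (i a))

/-- The interior product `ι_a w = w(a, ⋅, …, ⋅)`, lowering the degree by one. -/
def interiorProd {n : ℕ} {V : Type*} [NormedAddCommGroup V] [NormedSpace ℝ V]
    (a : V) (w : AltForm n V) : AltForm n V :=
  fun k => if h : (k : ℕ) + 1 < n + 1 then (w ⟨(k : ℕ) + 1, h⟩).curryLeft a else 0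

/-- Restriction of a form on `V` to a linear subspace `S`, that is, its pullback by the inclusion
`S → V`. -/
def altRestrict {n : ℕ} {V : Type*} [NormedAddCommGroup V] [NormedSpace ℝ V]
    (S : Submodule ℝ V) (w : AltForm n V) : AltForm n S :=
  fun k => (w k).compContinuousLinearMap S.subtypeL

/-! ## Euclidean space, codifferential, polynomial forms -/

/-- `ℝⁿ` with the Euclidean metric. -/
abbrev Euc (n : ℕ) : Type := EuclideanSpace ℝ (Fin n)

/-- The codifferential `δ w = - ∑_i ι_{e_i} ∂_i w` on `ℝⁿ`, the formal `L²`-adjoint of the exterior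
differential: it equals `(-1)^k ⋆⁻¹ d ⋆` on `k`-forms. -/
def codiff {n : ℕ} (w : Euc n → AltForm n (Euc n)) (x : Euc n) : AltForm n (Euc n) :=
  - ∑ i : Fin n, interiorProd (EuclideanSpace.single i (1 : ℝ))
      (fderiv ℝ w x (EuclideanSpace.single i (1 : ℝ)))

/-- Polynomial forms of degree at most `r`, homogeneous of form degree `j`, with values in `Alt V`,
on a flat space `V` that is placed in `ℝⁿ` by `emb`: finite sums `∑ p_i a_i` with polynomials `p_i`
on `ℝⁿ` of degree at most `r`, restricted along `emb`, and constant forms `a_i ∈ Alt^j V`. -/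
def polyForm {n : ℕ} {V : Type*} [NormedAddCommGroup V] [NormedSpace ℝ V]
    (emb : V → Euc n) (r : ℕ) (j : ℤ) : Submodule ℝ (V → AltForm n V) :=
  Submodule.span ℝ {w | ∃ p : MvPolynomial (Fin n) ℝ, ∃ a : AltForm n V,
    p.totalDegree ≤ r ∧ a ∈ altDeg n V j ∧
      w = fun x => MvPolynomial.eval (fun i => emb x i) p • a}

/-! ## Meshes -/

/-- `ν` is the outward unit normal of the open set `U` at `x`, near which `U` is a half space. -/
def IsOutwardNormal {n : ℕ} (U : Set (Euc n)) (x ν : Euc n) : Prop :=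
  ‖ν‖ = 1 ∧ ∃ ε > 0, ∀ y ∈ Metric.ball x ε, y ∈ U ↔ inner ℝ (y - x) ν < 0

/-- A flat facet in `ℝⁿ`: the set `{pt + t | t ∈ dom}`, with `dom` a bounded nonempty open subset of
the hyperplane of directions orthogonal to the unit vector `normal`. -/
structure FlatFacet (n : ℕ) where
  /-- A point of the hyperplane of the facet. -/
  pt : Euc n
  /-- A unit normal of the facet. -/
  normal : Euc n
  norm_normal : ‖normal‖ = 1
  /-- The facet, as a subset of its space of directions. -/
  dom : Set ((ℝ ∙ normal)ᗮ : Submodule ℝ (Euc n))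
  isOpen_dom : IsOpen dom
  nonempty_dom : dom.Nonempty
  isBounded_dom : Bornology.IsBounded dom

namespace FlatFacet

variable {n : ℕ} (e : FlatFacet n)

/-- The tangent space of the facet. -/
abbrev tangent : Submodule ℝ (Euc n) := (ℝ ∙ e.normal)ᗮ

/-- The isometric parametrization of the hyperplane of the facet by its tangent space. -/
def emb (t : e.tangent) : Euc n := e.pt + (t : Euc n)

/-- The facet as a subset of `ℝⁿ`. -/
def carrier : Set (Euc n) := e.emb '' e.dom

/-- Surface measure on the facet, carried to the tangent space: the Lebesgue measure for which unit
orthonormal cubes have measure `1`, restricted to the facet. -/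
def measure : Measure e.tangent :=
  ((stdOrthonormalBasis ℝ e.tangent).toBasis.addHaar).restrict e.dom

/-- `L²Λ(e)`; points of the facet are given by their parameters in the tangent space. -/
abbrev L2 : Type := Lp (AltForm n e.tangent) 2 e.measure

/-- The tangential trace on the facet of a form on `ℝⁿ`: its pullback to the facet. -/
def tanOn (w : Euc n → AltForm n (Euc n)) (t : e.tangent) : AltForm n e.tangent :=
  altRestrict e.tangent (w (e.emb t))

/-- The normal trace on the facet, with respect to the outward unit normal `ν`, of a form on `ℝⁿ`:
the pullback to the facet of the interior product `ι_ν w`.  It equals `⋆̂⁻¹ tr ⋆ w`: if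
`w = ν♭ ∧ a + b` with `a` and `b` tangential, then `tr ⋆ w = ⋆̂ a` for the orientation induced on the
facet, while `ι_ν w = a`. -/
def norOn (ν : Euc n) (w : Euc n → AltForm n (Euc n)) (t : e.tangent) : AltForm n e.tangent :=
  altRestrict e.tangent (interiorProd ν (w (e.emb t)))

end FlatFacet

/-- A partition `𝒯_h` of a bounded open set `Ω ⊆ ℝⁿ` into finitely many non-overlapping open cells
with flat facets (for instance a simplicial triangulation). -/
structure PolyMesh (n : ℕ) where
  /-- The domain. -/
  Ω : Set (Euc n)
  isOpen_Ω : IsOpen Ω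
  isBounded_Ω : Bornology.IsBounded Ω
  /-- The index set of the cells `K`. -/
  Cell : Type
  [fintypeCell : Fintype Cell]
  /-- The cells. -/
  cell : Cell → Set (Euc n)
  isOpen_cell : ∀ K, IsOpen (cell K)
  nonempty_cell : ∀ K, (cell K).Nonempty
  disjoint_cell : ∀ K L, K ≠ L → Disjoint (cell K) (cell L)
  cell_subset : ∀ K, cell K ⊆ Ω
  cover : Ω ⊆ ⋃ K, closure (cell K)
  /-- The index set of the facets `e`. -/
  Facet : Type
  /-- The facets. -/
  facet : Facet → FlatFacet n
  disjoint_facet : ∀ e e', e ≠ e' → Disjoint (facet e).carrier (facet e').carrier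
  /-- The facets contained in the boundary of a cell. -/
  facetsOf : Cell → Finset Facet
  mem_facetsOf : ∀ K e, e ∈ facetsOf K ↔ (facet e).carrier ⊆ frontier (cell K)
  /-- The boundary of a cell consists of its facets, up to a set of vanishing surface measure. -/
  frontier_cell : ∀ K, Measure.euclideanHausdorffMeasure (n - 1)
    (frontier (cell K) \ ⋃ e ∈ facetsOf K, (facet e).carrier) = 0
  /-- The sign `±1` for which `sgn K e • (facet e).normal` is the outward normal of `K` on `e`. -/
  sgn : Cell → Facet → ℝ
  outward : ∀ K, ∀ e ∈ facetsOf K, (sgn K e = 1 ∨ sgn K e = -1) ∧ ∀ x ∈ (facet e).carrier,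
    IsOutwardNormal (cell K) x (sgn K e • (facet e).normal)
  /-- A facet lies on the domain boundary and belongs to exactly one cell, or it is interior and
  shared by exactly two cells. -/
  boundary_or_interior : ∀ e,
    ((facet e).carrier ⊆ frontier Ω ∧ ∃! K, e ∈ facetsOf K) ∨
    ((facet e).carrier ⊆ Ω ∧ ∃ K K', K ≠ K' ∧ ∀ L, e ∈ facetsOf L ↔ L = K ∨ L = K')

attribute [instance] PolyMesh.fintypeCell

/-! ## Square integrability of traces of polynomial forms -/

theorem polyForm_continuous {n : ℕ} {r : ℕ} {j : ℤ} {w : Euc n → AltForm n (Euc n)}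
    (hw : w ∈ polyForm id r j) : Continuous w := by
  induction hw using Submodule.span_induction with
  | mem w h =>
    obtain ⟨p, a, -, -, rfl⟩ := h
    have h1 : Continuous fun x : Euc n => MvPolynomial.eval (fun i => (id x : Euc n) i) p :=
      (MvPolynomial.continuous_eval p).comp (by fun_prop)
    exact h1.smul continuous_const
  | zero => exact continuous_const
  | add x y _ _ hx hy => exact hx.add hy
  | smul c x _ hx => exact hx.const_smul c

theorem polyForm_mem_altDeg {n : ℕ} {r : ℕ} {j : ℤ} {w : Euc n → AltForm n (Euc n)}
    (hw : w ∈ polyForm id r j) (x : Euc n) : w x ∈ altDeg n (Euc n) j := by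
  induction hw using Submodule.span_induction with
  | mem w h =>
    obtain ⟨p, a, -, ha, rfl⟩ := h
    exact Submodule.smul_mem _ _ ha
  | zero => exact Submodule.zero_mem _
  | add x y _ _ hx hy => exact Submodule.add_mem _ hx hy
  | smul c x _ hx => exact Submodule.smul_mem _ c hx

theorem altRestrict_mem_altDeg {n : ℕ} (S : Submodule ℝ (Euc n)) {j : ℤ}
    {w : AltForm n (Euc n)} (hw : w ∈ altDeg n (Euc n) j) :
    altRestrict S w ∈ altDeg n S j := by
  intro k hk
  ext v
  simp [altRestrict, hw k hk]

theorem continuous_interiorProd {n : ℕ} (a : Euc n) :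
    Continuous (interiorProd a : AltForm n (Euc n) → AltForm n (Euc n)) := by
  refine continuous_pi fun k => ?_
  by_cases h : (k : ℕ) + 1 < n + 1
  · simp only [interiorProd, h, dite_true]
    have h1 : Continuous fun f : Euc n [⋀^Fin ((k : ℕ) + 1)]→L[ℝ] ℝ => f.curryLeft a :=
      (ContinuousLinearMap.apply ℝ _ a).continuous.comp
        (ContinuousAlternatingMap.curryLeftLI
          (𝕜 := ℝ) (E := Euc n) (F := ℝ) (n := (k : ℕ))).continuous
    exact h1.comp (continuous_apply (⟨(k : ℕ) + 1, h⟩ : Fin (n + 1)))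
  · simp only [interiorProd, h, dite_false]
    exact continuous_const

theorem continuous_altRestrict {n : ℕ} (S : Submodule ℝ (Euc n)) :
    Continuous (altRestrict S : AltForm n (Euc n) → AltForm n S) := by
  refine continuous_pi fun k => ?_
  exact (ContinuousAlternatingMap.compContinuousLinearMapCLM S.subtypeL).continuous.comp
    (continuous_apply k)

namespace FlatFacet

variable {n : ℕ} (e : FlatFacet n)

theorem continuous_emb : Continuous e.emb := by
  unfold emb
  fun_prop

theorem measure_univ_lt_top : e.measure univ < ⊤ := by
  rw [measure, Measure.restrict_apply_univ]
  exact e.isBounded_dom.measure_lt_top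

theorem memLp_of_continuous {w : e.tangent → AltForm n e.tangent} (hw : Continuous w) :
    MemLp w 2 e.measure := by
  have : IsFiniteMeasure e.measure := ⟨e.measure_univ_lt_top⟩
  obtain ⟨C, hC⟩ := (e.isBounded_dom.isCompact_closure.image hw).isBounded.exists_norm_le
  have : SecondCountableTopologyEither e.tangent (AltForm n e.tangent) :=
    secondCountableTopologyEither_of_left _ _
  refine MemLp.of_bound hw.aestronglyMeasurable C ?_
  refine (ae_restrict_iff' e.isOpen_dom.measurableSet).2 (Eventually.of_forall fun t ht => ?_)
  exact hC _ (mem_image_of_mem w (subset_closure ht))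

theorem memLp_tanOn {w : Euc n → AltForm n (Euc n)} (hw : Continuous w) :
    MemLp (e.tanOn w) 2 e.measure :=
  e.memLp_of_continuous ((continuous_altRestrict _).comp (hw.comp e.continuous_emb))

theorem memLp_norOn (ν : Euc n) {w : Euc n → AltForm n (Euc n)} (hw : Continuous w) :
    MemLp (e.norOn ν w) 2 e.measure :=
  e.memLp_of_continuous ((continuous_altRestrict _).comp
    ((continuous_interiorProd ν).comp (hw.comp e.continuous_emb)))

end FlatFacet

namespace PolyMesh

variable {n : ℕ} (M : PolyMesh n)

/-- A facet on the boundary of the domain. -/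
def IsBdry (e : M.Facet) : Prop := (M.facet e).carrier ⊆ frontier M.Ω

/-! ## Spaces of forms and traces -/

/-- The broken space `W_h^j = ∏_K 𝒫_r Λ^j(K)`.  A polynomial form on a cell is represented by its
(unique) polynomial extension to `ℝⁿ`. -/
def W (r : ℕ) (j : ℤ) : Submodule ℝ (M.Cell → Euc n → AltForm n (Euc n)) :=
  Submodule.pi univ fun _ => polyForm id r j

/-- `L²Λ^j(Ω)`. -/
def DomL2 (j : ℤ) : Submodule ℝ (Lp (AltForm n (Euc n)) 2 (volume.restrict M.Ω)) where
  carrier := {w | ∀ᵐ x ∂(volume.restrict M.Ω), w x ∈ altDeg n (Euc n) j}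
  add_mem' := by
    intro a b ha hb
    filter_upwards [ha, hb, Lp.coeFn_add a b] with t h1 h2 h3
    rw [h3]
    exact Submodule.add_mem _ h1 h2
  zero_mem' := by
    filter_upwards [Lp.coeFn_zero (AltForm n (Euc n)) 2 (volume.restrict M.Ω)] with t h
    rw [h]
    exact Submodule.zero_mem _
  smul_mem' := by
    intro c a ha
    filter_upwards [ha, Lp.coeFn_smul c a] with t h1 h3
    rw [h3]
    exact Submodule.smul_mem _ c h1

/-- `L²Λ(∂𝒯_h) = ∏_K ∏_{e ⊆ ∂K} L²Λ(e)`; its elements are double-valued on interior facets. -/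
abbrev SkelL2 : Type := (K : M.Cell) → (e : M.facetsOf K) → (M.facet e).L2

/-- `L²Λ^j(∂𝒯_h)`. -/
def SkelL2Deg (j : ℤ) : Submodule ℝ M.SkelL2 where
  carrier := {w | ∀ (K : M.Cell) (e : M.facetsOf K), ∀ᵐ t ∂(M.facet e).measure,
    w K e t ∈ altDeg n (M.facet e).tangent j}
  add_mem' := by
    intro a b ha hb K e
    filter_upwards [ha K e, hb K e, Lp.coeFn_add (a K e) (b K e)] with t h1 h2 h3
    change (a K e + b K e : (M.facet e).L2) t ∈ _
    rw [h3]
    exact Submodule.add_mem _ h1 h2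
  zero_mem' := by
    intro K e
    filter_upwards [Lp.coeFn_zero (AltForm n (M.facet e).tangent) 2 (M.facet e).measure] with t h
    change (0 : (M.facet e).L2) t ∈ _
    rw [h]
    exact Submodule.zero_mem _
  smul_mem' := by
    intro c a ha K e
    filter_upwards [ha K e, Lp.coeFn_smul c (a K e)] with t h1 h3
    change (c • a K e : (M.facet e).L2) t ∈ _
    rw [h3]
    exact Submodule.smul_mem _ c h1

/-- Membership in `V̂_h^{j,tan}`: on each facet the trace is a form in `𝒫_r Λ^j(e)`, and on interior
facets the tangential jump vanishes, that is, the traces from the two sides agree. -/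
def VHat (r : ℕ) (j : ℤ) (w : M.SkelL2Deg j) : Prop :=
  (∀ (K : M.Cell) (e : M.facetsOf K), ∃ p ∈ polyForm (M.facet e).emb r j,
    (w.1 K e : (M.facet e).tangent → AltForm n (M.facet e).tangent) =ᵐ[(M.facet e).measure] p) ∧
  ∀ e : M.Facet, ¬ M.IsBdry e → ∀ (K K' : M.Cell) (h : e ∈ M.facetsOf K) (h' : e ∈ M.facetsOf K'),
    w.1 K ⟨e, h⟩ = w.1 K' ⟨e, h'⟩

/-- The two traces agree on `∂Ω`. -/
def EqOnBdry {j : ℤ} (v w : M.SkelL2Deg j) : Prop :=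
  ∀ (K : M.Cell) (e : M.facetsOf K), M.IsBdry e → v.1 K e = w.1 K e

/-- Membership in the subspace of `V̂_h^{j,tan}` with vanishing tangential jump on all facets.  On
`∂Ω` the jump is the trace itself. -/
def VRing (r : ℕ) (j : ℤ) (w : M.SkelL2Deg j) : Prop := M.VHat r j w ∧ M.EqOnBdry w 0

/-! ## Inner products, codifferential and traces of broken forms -/

/-- The `L²` inner product `(v, w)_{𝒯_h}` of broken forms. -/
def cellPair (v w : M.Cell → Euc n → AltForm n (Euc n)) : ℝ :=
  ∑ K, ∫ x in M.cell K, altInner (v K x) (w K x)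

/-- The `L²` inner product `⟨v, w⟩_{∂𝒯_h}`. -/
def skelPair (v w : M.SkelL2) : ℝ :=
  ∑ K, ∑ e : M.facetsOf K, ∫ t, altInner (v K e t) (w K e t) ∂(M.facet e).measure

/-- The cellwise codifferential of a broken form. -/
def brokenCodiff (w : M.Cell → Euc n → AltForm n (Euc n)) : M.Cell → Euc n → AltForm n (Euc n) :=
  fun K => codiff (w K)

variable {M}

theorem W_continuous {r : ℕ} {j : ℤ} (w : M.W r j) (K : M.Cell) : Continuous (w.1 K) :=
  polyForm_continuous (w.2 K (mem_univ K))

/-- The tangential trace `w_h^tan ∈ L²Λ^j(∂𝒯_h)` of `w_h ∈ W_h^j`. -/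
def tanTr {r : ℕ} {j : ℤ} (w : M.W r j) : M.SkelL2Deg j :=
  ⟨fun K e => ((M.facet e).memLp_tanOn (W_continuous w K)).toLp _, by
    intro K e
    filter_upwards [((M.facet e).memLp_tanOn (W_continuous w K)).coeFn_toLp] with t ht
    rw [ht]
    exact altRestrict_mem_altDeg _ (polyForm_mem_altDeg (w.2 K (mem_univ K)) _)⟩

/-- The normal trace `w_h^nor ∈ L²Λ(∂𝒯_h)` of `w_h ∈ W_h^j`, of form degree `j - 1`, with respect to
the outward normals of the cells. -/
def norTr {r : ℕ} {j : ℤ} (w : M.W r j) : M.SkelL2 :=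
  fun K e => ((M.facet e).memLp_norOn (M.sgn K e • (M.facet e).normal) (W_continuous w K)).toLp _

/-! ## The LDG-H method for the semilinear Hodge wave equation -/

/-- The operator `α` on `L²Λ^j(∂𝒯_h)` is symmetric. -/
def IsSymm {j : ℤ} (α : M.SkelL2Deg j →L[ℝ] M.SkelL2Deg j) : Prop :=
  ∀ v w, M.skelPair (α v).1 w.1 = M.skelPair v.1 (α w).1

/-- The operator `α` on `L²Λ^j(∂𝒯_h)` is positive-definite. -/
def IsPosDef {j : ℤ} (α : M.SkelL2Deg j →L[ℝ] M.SkelL2Deg j) : Prop :=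
  ∀ w, w ≠ 0 → 0 < M.skelPair (α w).1 w.1

/-- The operator `α` on `L²Λ^j(∂𝒯_h)` is negative-definite. -/
def IsNegDef {j : ℤ} (α : M.SkelL2Deg j →L[ℝ] M.SkelL2Deg j) : Prop :=
  ∀ w, w ≠ 0 → M.skelPair (α w).1 w.1 < 0

variable (M) in
/-- The unknowns that are determined by `u_h`: `σ_h ∈ W_h^{k-1}`, `ρ_h ∈ W_h^{k+1}` and the numerical
traces `σ̂_h^tan` and `û_h^tan` on the whole skeleton. -/
structure Aux (r : ℕ) (k : ℤ) where
  σ : M.W r (k - 1)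
  ρ : M.W r (k + 1)
  σhat : M.SkelL2Deg (k - 1)
  uhat : M.SkelL2Deg k

/-- The two constraints and the two conservativity conditions of the LDG-H method, for `u_h ∈ W_h^k`,
together with `σ̂_h^tan ∈ V̂_h^{k-1,tan}`, `û_h^tan ∈ V̂_h^{k,tan}` and the boundary conditions that these
traces agree with `gσ` and `gu` on `∂Ω`. -/
structure Aux.Solves {r : ℕ} {k : ℤ} (z : M.Aux r k)
    (α' : M.SkelL2Deg (k - 1) →L[ℝ] M.SkelL2Deg (k - 1)) (α : M.SkelL2Deg k →L[ℝ] M.SkelL2Deg k)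
    (gσ : M.SkelL2Deg (k - 1)) (gu : M.SkelL2Deg k) (u : M.W r k) : Prop where
  σhat_mem : M.VHat r (k - 1) z.σhat
  uhat_mem : M.VHat r k z.uhat
  σhat_bdry : M.EqOnBdry z.σhat gσ
  uhat_bdry : M.EqOnBdry z.uhat gu
  /-- `(δu, τ) + ⟨α^{k-1}(σ̂ - σ), τ⟩ = -(σ, τ)` -/
  constraint_σ : ∀ τ : M.W r (k - 1),
    M.cellPair (M.brokenCodiff u.1) τ.1 + M.skelPair (α' (z.σhat - tanTr z.σ)).1 (tanTr τ).1
      = - M.cellPair z.σ.1 τ.1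
  /-- `(u, δη) + ⟨û, η^nor⟩ = -(ρ, η)` -/
  constraint_ρ : ∀ η : M.W r (k + 1),
    M.cellPair u.1 (M.brokenCodiff η.1) + M.skelPair z.uhat.1 (norTr η)
      = - M.cellPair z.ρ.1 η.1
  /-- `⟨u^nor - α^{k-1}(σ̂ - σ), τ̂⟩ = 0` -/
  conserv_σ : ∀ τhat : M.SkelL2Deg (k - 1), M.VRing r (k - 1) τhat →
    M.skelPair (norTr u - (α' (z.σhat - tanTr z.σ)).1) τhat.1 = 0
  /-- `⟨ρ^nor - α^k(û - u), v̂⟩ = 0` -/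
  conserv_u : ∀ vhat : M.SkelL2Deg k, M.VRing r k vhat →
    M.skelPair (norTr z.ρ - (α (z.uhat - tanTr u)).1) vhat.1 = 0

/-- The dynamical equations of the LDG-H method for the velocities `u̇ = u'` and `ṗ = p'`, where
`F = f(t, u_h)`. -/
structure DynEq {r : ℕ} {k : ℤ} (α : M.SkelL2Deg k →L[ℝ] M.SkelL2Deg k) (F : M.DomL2 k)
    (u p : M.W r k) (z : M.Aux r k) (u' p' : M.W r k) : Prop where
  /-- `(u̇, r) = (p, r)` -/
  u_eq : ∀ s : M.W r k, M.cellPair u'.1 s.1 = M.cellPair p.1 s.1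
  /-- `-(ṗ, v) + (σ, δv) + (δρ, v) + ⟨σ̂, v^nor⟩ + ⟨α^k(û - u), v^tan⟩ = (f(t, u), v)` -/
  p_eq : ∀ v : M.W r k,
    - M.cellPair p'.1 v.1 + M.cellPair z.σ.1 (M.brokenCodiff v.1)
      + M.cellPair (M.brokenCodiff z.ρ.1) v.1 + M.skelPair z.σhat.1 (norTr v)
      + M.skelPair (α (z.uhat - tanTr u)).1 (tanTr v).1
      = M.cellPair (fun _ => F.1) v.1

/-- `(u, p, z)` is a solution of the LDG-H method on the time interval `J`, with source `f` and
boundary data `gσ`, `gu`.  Since `W_h^k` is a finite-dimensional space of functions, the time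
derivatives of `u` and `p` may be taken pointwise in space. -/
structure IsSolution {r : ℕ} {k : ℤ} (α' : M.SkelL2Deg (k - 1) →L[ℝ] M.SkelL2Deg (k - 1))
    (α : M.SkelL2Deg k →L[ℝ] M.SkelL2Deg k) (f : ℝ → M.W r k → M.DomL2 k)
    (gσ : ℝ → M.SkelL2Deg (k - 1)) (gu : ℝ → M.SkelL2Deg k) (J : Set ℝ)
    (u p : ℝ → M.W r k) (z : ℝ → M.Aux r k) : Prop where
  constraints : ∀ t ∈ J, (z t).Solves α' α (gσ t) (gu t) (u t)
  dynamics : ∀ t ∈ J, ∃ u' p' : M.W r k,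
    (∀ K x, HasDerivWithinAt (fun s => (u s).1 K x) (u'.1 K x) J t) ∧
    (∀ K x, HasDerivWithinAt (fun s => (p s).1 K x) (p'.1 K x) J t) ∧
    DynEq α (f t (u t)) (u t) (p t) (z t) u' p'

/-- The source `f : I × W_h^k → L²Λ^k(Ω)` is continuous, and `C¹` in its second argument: it has
directional derivatives `Df`, continuous in all arguments.  Here `W_h^k` carries its topology as a
finite-dimensional space, which is that of pointwise convergence. -/
def IsC1Source {r : ℕ} {k : ℤ} (I : Set ℝ) (f : ℝ → M.W r k → M.DomL2 k) : Prop :=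
  ContinuousOn (fun q : ℝ × M.W r k => f q.1 q.2) (I ×ˢ univ) ∧
  ∃ Df : ℝ → M.W r k → M.W r k → M.DomL2 k,
    (∀ t ∈ I, ∀ u v, HasDerivAt (fun s : ℝ => f t (u + s • v)) (Df t u v) 0) ∧
    ContinuousOn (fun q : ℝ × M.W r k × M.W r k => Df q.1 q.2.1 q.2.2) (I ×ˢ univ)

end PolyMesh

end

noncomputable section

/-! ## Ordinary differential equations with continuously differentiable right-hand side -/

/-! For fixed `u_h` and boundary data the unknowns split into two independent linear problems, one
for `(σ_h, σ̂_h)` and one for `(ρ_h, û_h)`. Each numerical trace is a fixed lift of the boundary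
data plus an unknown in the space of traces vanishing on `∂Ω`, so both problems are square and
finite-dimensional, and it suffices that the associated bilinear form vanishes on the diagonal only
at zero (`exists_linearMap_solution`).

In the first problem, add the constraint tested with `τ` to the conservativity condition tested with
`τ̂`. The diagonal of the resulting form is `(σ, σ) - ⟨α^{k-1}(σ̂ - σ), σ̂ - σ⟩`, a sum of two
nonnegative terms because `α^{k-1}` is negative-definite. If it vanishes, then `σ = 0` and the jump
is zero, hence `σ̂ = 0` (`exists_linearMap_solution_of_neg`). In the second problem, subtract the
conservativity condition from the constraint. The coupling terms `⟨û, η^nor⟩` and `⟨v̂, ρ^nor⟩` are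
then skew and cancel on the diagonal, which leaves `(ρ, ρ) + ⟨α^k û, û⟩`
(`exists_linearMap_solution_of_pos`). Definiteness of the cell inner product on polynomial forms
comes from the identity theorem, as each cell is open and nonempty.

The auxiliary unknowns are therefore linear in `(u_h, data)`. By Riesz representation on `W_h^k` the
dynamics become `u̇ = p`, `ṗ = A(u, data) + N f(t, u)` with continuous linear `A` and `N`
(`exists_velocity`). In coordinates this is a second-order ODE whose right-hand side is continuous,
with jointly continuous directional derivatives in the state. It is thus Lipschitz on compact convex
sets, and Picard–Lindelöf and Grönwall give local existence and uniqueness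
(`exists_solution_functionSpace`). Equal `u` then forces equal auxiliary unknowns. -/

/-- A map with jointly continuous directional derivatives is Lipschitz on compact convex sets,
uniformly for times in a compact set. -/
theorem exists_lipschitzOnWith_of_hasDerivAt_line {E F : Type*}
    [NormedAddCommGroup E] [NormedSpace ℝ E] [ProperSpace E]
    [NormedAddCommGroup F] [NormedSpace ℝ F] {T : Set ℝ} (hT : IsCompact T)
    {v : ℝ → E → F} {Dv : ℝ → E → E → F}
    (hv : ∀ t ∈ T, ∀ x y, HasDerivAt (fun s : ℝ => v t (x + s • y)) (Dv t x y) 0)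
    (hc : ContinuousOn (fun q : ℝ × E × E => Dv q.1 q.2.1 q.2.2) (T ×ˢ univ))
    {B : Set E} (hB : IsCompact B) (hBc : Convex ℝ B) :
    ∃ K : NNReal, ∀ t ∈ T, LipschitzOnWith K (v t) B := by
  -- Directions are needed only in the unit ball, because segments in `B` are parametrised by arc
  -- length below.
  obtain ⟨C, hC⟩ := (hT.prod (hB.prod (isCompact_closedBall (0 : E) 1))).exists_bound_of_continuousOn
    (hc.mono (prod_mono le_rfl (subset_univ _)))
  refine ⟨C.toNNReal, fun t ht => LipschitzOnWith.of_dist_le_mul fun x hx z hz => ?_⟩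
  rw [dist_comm, dist_comm x z, dist_eq_norm, dist_eq_norm]
  rcases eq_or_ne z x with rfl | hne
  · simp
  have hL : 0 < ‖z - x‖ := norm_pos_iff.2 (sub_ne_zero.2 hne)
  set L := ‖z - x‖ with hLdef
  set y : E := L⁻¹ • (z - x) with hy
  have hLy : L • y = z - x := by rw [hy, smul_smul, mul_inv_cancel₀ hL.ne', one_smul]
  have hyn : ‖y‖ ≤ 1 := by
    rw [hy, norm_smul, norm_inv, Real.norm_of_nonneg hL.le, ← hLdef, inv_mul_cancel₀ hL.ne']
  have hd : ∀ s ∈ Icc (0 : ℝ) L,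
      HasDerivWithinAt (fun s : ℝ => v t (x + s • y)) (Dv t (x + s • y) y) (Icc 0 L) s := by
    intro s _
    -- The hypothesis gives derivatives at parameter `0` only; moving the base point to `x + s • y`
    -- and shifting the parameter gives them at `s`.
    have h1 := hv t ht (x + s • y) y
    have h2 : HasDerivAt (fun s' : ℝ => s' - s) 1 s := (hasDerivAt_id s).sub_const s
    have h3 : HasDerivAt (fun s' : ℝ => v t (x + s • y + s' • y)) (Dv t (x + s • y) y) (s - s) := by
      simpa using h1
    have h4 := HasDerivAt.scomp (h := fun s' => s' - s) s h3 h2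
    refine HasDerivAt.hasDerivWithinAt ?_
    convert! h4 using 1
    · ext s'
      simp only [Function.comp]
      congr 1
      rw [sub_smul]
      abel
    · simp
  have hmem : ∀ s ∈ Icc (0 : ℝ) L, x + s • y ∈ B := by
    intro s hs
    have h1 : x + s • y = x + (s / L) • (z - x) := by
      rw [hy, smul_smul, div_eq_mul_inv]
    rw [h1]
    exact hBc.add_smul_sub_mem hx hz ⟨div_nonneg hs.1 hL.le, (div_le_one hL).2 hs.2⟩
  have key := (convex_Icc (0 : ℝ) L).norm_image_sub_le_of_norm_hasDerivWithin_le (C := C) hd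
    (fun s hs => hC (t, x + s • y, y) ⟨ht, hmem s hs, by simpa using hyn⟩)
    (left_mem_Icc.2 hL.le) (right_mem_Icc.2 hL.le)
  simp only [zero_smul, add_zero, sub_zero, hLy, add_sub_cancel, Real.norm_of_nonneg hL.le] at key
  exact key.trans (mul_le_mul_of_nonneg_right (Real.le_coe_toNNReal C) hL.le)

/-- Near one of its points, an interval is a compact interval. -/
theorem exists_inter_Icc_eq_Icc {I : Set ℝ} (hI : I.OrdConnected) {t₀ : ℝ} (ht₀ : t₀ ∈ I) :
    ∃ ε₀ > 0, ∀ ε, 0 < ε → ε ≤ ε₀ → ∃ a b : ℝ, a ≤ t₀ ∧ t₀ ≤ b ∧ t₀ - ε ≤ a ∧ b ≤ t₀ + ε ∧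
      I ∩ Icc (t₀ - ε) (t₀ + ε) = Icc a b := by
  have hl : ∃ ε₀ > 0, ∀ ε, 0 < ε → ε ≤ ε₀ → ∃ a, a ≤ t₀ ∧ t₀ - ε ≤ a ∧ a ∈ I ∧
      ∀ t ∈ I, t₀ - ε ≤ t → a ≤ t := by
    -- Either `I` extends to the left of `t₀` and the window ends inside `I`, or `t₀` is the left
    -- endpoint of `I` and the window is cut off there; in the latter case any `ε₀` works.
    by_cases h : ∃ s ∈ I, s < t₀
    · obtain ⟨s, hs, hst⟩ := h
      refine ⟨t₀ - s, sub_pos.2 hst, fun ε h0 hε => ⟨t₀ - ε, by linarith, le_rfl,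
        hI.out hs ht₀ ⟨by linarith, by linarith⟩, fun t _ h => h⟩⟩
    · push Not at h
      exact ⟨1, one_pos, fun ε h0 _ => ⟨t₀, le_rfl, by linarith, ht₀, fun t ht _ => h t ht⟩⟩
  have hr : ∃ ε₀ > 0, ∀ ε, 0 < ε → ε ≤ ε₀ → ∃ b, t₀ ≤ b ∧ b ≤ t₀ + ε ∧ b ∈ I ∧
      ∀ t ∈ I, t ≤ t₀ + ε → t ≤ b := by
    by_cases h : ∃ s ∈ I, t₀ < s
    · obtain ⟨s, hs, hst⟩ := h
      refine ⟨s - t₀, sub_pos.2 hst, fun ε h0 hε => ⟨t₀ + ε, by linarith, le_rfl,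
        hI.out ht₀ hs ⟨by linarith, by linarith⟩, fun t _ h => h⟩⟩
    · push Not at h
      exact ⟨1, one_pos, fun ε h0 _ => ⟨t₀, le_rfl, by linarith, ht₀, fun t ht _ => h t ht⟩⟩
  obtain ⟨ε₁, h1, hl⟩ := hl
  obtain ⟨ε₂, h2, hr⟩ := hr
  refine ⟨min ε₁ ε₂, lt_min h1 h2, fun ε h0 hε => ?_⟩
  obtain ⟨a, ha, ha', haI, hal⟩ := hl ε h0 (hε.trans (min_le_left _ _))
  obtain ⟨b, hb, hb', hbI, hbr⟩ := hr ε h0 (hε.trans (min_le_right _ _))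
  refine ⟨a, b, ha, hb, ha', hb', ?_⟩
  ext t
  constructor
  · rintro ⟨ht, h3, h4⟩
    exact ⟨hal t ht h3, hbr t ht h4⟩
  · rintro ⟨h3, h4⟩
    exact ⟨hI.out haI hbI ⟨h3, h4⟩, by linarith, by linarith⟩

/-! ### Picard–Lindelöf and Grönwall on arbitrary intervals -/

section Flow

variable {E : Type*} [NormedAddCommGroup E] [NormedSpace ℝ E] [ProperSpace E]
  {I : Set ℝ} {v : ℝ → E → E} {Dv : ℝ → E → E → E}

/-- Local existence of solutions on an arbitrary interval. -/
theorem exists_hasDerivWithinAt_of_hasDerivAt_line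
    (hI : I.OrdConnected) (hvc : ContinuousOn (fun q : ℝ × E => v q.1 q.2) (I ×ˢ univ))
    (hv : ∀ t ∈ I, ∀ x y, HasDerivAt (fun s : ℝ => v t (x + s • y)) (Dv t x y) 0)
    (hc : ContinuousOn (fun q : ℝ × E × E => Dv q.1 q.2.1 q.2.2) (I ×ˢ univ))
    {t₀ : ℝ} (ht₀ : t₀ ∈ I) (x₀ : E) :
    ∃ ε > 0, ∃ y : ℝ → E, y t₀ = x₀ ∧ ∀ t ∈ I ∩ Icc (t₀ - ε) (t₀ + ε),
      HasDerivWithinAt y (v t (y t)) (I ∩ Icc (t₀ - ε) (t₀ + ε)) t := by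
  have : CompleteSpace E := inferInstance
  obtain ⟨ε₀, hε₀, h⟩ := exists_inter_Icc_eq_Icc hI ht₀
  obtain ⟨a₀, b₀, -, -, -, -, h₀⟩ := h ε₀ hε₀ le_rfl
  have hT : IsCompact (I ∩ Icc (t₀ - ε₀) (t₀ + ε₀)) := h₀ ▸ isCompact_Icc
  have hB : IsCompact (Metric.closedBall x₀ 1) := isCompact_closedBall _ _
  obtain ⟨C, hC⟩ := (hT.prod hB).exists_bound_of_continuousOn
    (hvc.mono (prod_mono inter_subset_left (subset_univ _)))
  obtain ⟨K, hK⟩ := exists_lipschitzOnWith_of_hasDerivAt_line hT (fun t ht => hv t ht.1)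
    (hc.mono (prod_mono inter_subset_left le_rfl)) hB (convex_closedBall _ _)
  -- The speed is at most `D` on the unit ball around `x₀`, so during a time `D⁻¹` a solution cannot
  -- leave that ball; the added `1` keeps `D` positive.
  set D : NNReal := C.toNNReal + 1
  have hD : 0 < (D : ℝ) := by positivity
  set ε := min ε₀ (D : ℝ)⁻¹
  have hε : 0 < ε := lt_min hε₀ (inv_pos.2 hD)
  obtain ⟨a, b, ha, hb, ha', hb', hab⟩ := h ε hε (min_le_left _ _)
  have hsub : Icc a b ⊆ I ∩ Icc (t₀ - ε₀) (t₀ + ε₀) := by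
    rw [← hab]
    refine inter_subset_inter_right _ (Icc_subset_Icc ?_ ?_) <;>
      linarith [min_le_left ε₀ (D : ℝ)⁻¹]
  have hPL : IsPicardLindelof v (⟨t₀, ha, hb⟩ : Icc a b) x₀ 1 0 D K :=
    { lipschitzOnWith := fun t ht => by simpa using hK t (hsub ht)
      continuousOn := fun x _ => by
        refine hvc.comp (by fun_prop) (s := Icc a b) (f := fun t => (t, x)) fun t ht =>
          ⟨(hsub ht).1, mem_univ _⟩
      norm_le := fun t ht x hx => by
        refine (hC (t, x) ⟨hsub ht, by simpa using hx⟩).trans ?_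
        have := Real.le_coe_toNNReal C
        simp only [D, NNReal.coe_add, NNReal.coe_one]
        linarith
      mul_max_le := by
        have h1 : max (b - t₀) (t₀ - a) ≤ (D : ℝ)⁻¹ :=
          (max_le (by linarith) (by linarith)).trans (min_le_right ε₀ _)
        calc (D : ℝ) * max (b - t₀) (t₀ - a) ≤ D * (D : ℝ)⁻¹ :=
              mul_le_mul_of_nonneg_left h1 hD.le
          _ = 1 := mul_inv_cancel₀ hD.ne'
          _ = _ := by simp }
  obtain ⟨y, hy0, hy⟩ := hPL.exists_eq_forall_mem_Icc_hasDerivWithinAt₀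
  exact ⟨ε, hε, y, hy0, hab ▸ hy⟩

/-- Uniqueness of solutions on an arbitrary interval. -/
theorem eqOn_of_hasDerivWithinAt_of_hasDerivAt_line {J : Set ℝ} (hJ : J.OrdConnected)
    (hv : ∀ t ∈ J, ∀ x y, HasDerivAt (fun s : ℝ => v t (x + s • y)) (Dv t x y) 0)
    (hc : ContinuousOn (fun q : ℝ × E × E => Dv q.1 q.2.1 q.2.2) (J ×ˢ univ))
    {t₀ : ℝ} (ht₀ : t₀ ∈ J) {y z : ℝ → E}
    (hy : ∀ t ∈ J, HasDerivWithinAt y (v t (y t)) J t)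
    (hz : ∀ t ∈ J, HasDerivWithinAt z (v t (z t)) J t) (h0 : y t₀ = z t₀) : EqOn y z J := by
  have hyc : ContinuousOn y J := fun t ht => (hy t ht).continuousWithinAt
  have hzc : ContinuousOn z J := fun t ht => (hz t ht).continuousWithinAt
  -- No global Lipschitz bound is available. On a compact time interval, however, both curves stay
  -- in one closed ball, where the right-hand side is Lipschitz.
  have key : ∀ a ∈ J, ∀ b ∈ J, ∃ (K : NNReal) (B : Set E),
      (∀ t ∈ Icc a b, LipschitzOnWith K (v t) B) ∧ (∀ t ∈ Icc a b, y t ∈ B) ∧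
      ∀ t ∈ Icc a b, z t ∈ B := by
    intro a ha b hb
    have hs : Icc a b ⊆ J := hJ.out ha hb
    obtain ⟨R₁, h1⟩ := isCompact_Icc.exists_bound_of_continuousOn (hyc.mono hs)
    obtain ⟨R₂, h2⟩ := isCompact_Icc.exists_bound_of_continuousOn (hzc.mono hs)
    obtain ⟨K, hK⟩ := exists_lipschitzOnWith_of_hasDerivAt_line isCompact_Icc
      (fun t ht => hv t (hs ht)) (hc.mono (prod_mono hs le_rfl))
      (isCompact_closedBall (0 : E) (max R₁ R₂)) (convex_closedBall _ _)
    refine ⟨K, _, hK, fun t ht => ?_, fun t ht => ?_⟩ <;> rw [mem_closedBall_zero_iff]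
    exacts [(h1 t ht).trans (le_max_left _ _), (h2 t ht).trans (le_max_right _ _)]
  intro t ht
  rcases le_total t₀ t with hle | hle
  · obtain ⟨K, B, hK, hB1, hB2⟩ := key t₀ ht₀ t ht
    have hs : Icc t₀ t ⊆ J := hJ.out ht₀ ht
    have hd : ∀ w : ℝ → E, (∀ t ∈ J, HasDerivWithinAt w (v t (w t)) J t) →
        ∀ s ∈ Ico t₀ t, HasDerivWithinAt w (v s (w s)) (Ici s) s := fun w hw s hs' =>
      ((hw s (hs (Ico_subset_Icc_self hs'))).mono hs).mono_of_mem_nhdsWithin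
        (Icc_mem_nhdsGE_of_mem hs')
    exact ODE_solution_unique_of_mem_Icc_right (s := fun _ => B)
      (fun s hs' => hK s (Ico_subset_Icc_self hs')) (hyc.mono hs) (hd y hy)
      (fun s hs' => hB1 s (Ico_subset_Icc_self hs')) (hzc.mono hs) (hd z hz)
      (fun s hs' => hB2 s (Ico_subset_Icc_self hs')) h0 (right_mem_Icc.2 hle)
  · obtain ⟨K, B, hK, hB1, hB2⟩ := key t ht t₀ ht₀
    have hs : Icc t t₀ ⊆ J := hJ.out ht ht₀
    have hd : ∀ w : ℝ → E, (∀ t ∈ J, HasDerivWithinAt w (v t (w t)) J t) →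
        ∀ s ∈ Ioc t t₀, HasDerivWithinAt w (v s (w s)) (Iic s) s := fun w hw s hs' =>
      ((hw s (hs (Ioc_subset_Icc_self hs'))).mono hs).mono_of_mem_nhdsWithin
        (Icc_mem_nhdsLE_of_mem hs')
    exact ODE_solution_unique_of_mem_Icc_left (s := fun _ => B)
      (fun s hs' => hK s (Ioc_subset_Icc_self hs')) (hyc.mono hs) (hd y hy)
      (fun s hs' => hB1 s (Ioc_subset_Icc_self hs')) (hzc.mono hs) (hd z hz)
      (fun s hs' => hB2 s (Ioc_subset_Icc_self hs')) h0 (left_mem_Icc.2 hle)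

end Flow

/-- Differentiation of a curve in a topological vector space, expressed through coordinates. -/
theorem hasDerivWithinAt_comp_equiv_iff {X ι F : Type*} [NormedAddCommGroup F] [NormedSpace ℝ F]
    {W : Submodule ℝ (X → ι → F)} {E : Type*} [NormedAddCommGroup E] [NormedSpace ℝ E]
    (e : W ≃L[ℝ] E) (u : ℝ → W) (u' : W) (J : Set ℝ) (t : ℝ) :
    HasDerivWithinAt (fun s => e (u s)) (e u') J t ↔
      ∀ K x, HasDerivWithinAt (fun s => (u s).1 K x) (u'.1 K x) J t := by
  -- Slopes commute with linear maps, and convergence in `W`, a subspace of a product, is pointwise.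
  -- Both sides therefore say that the slopes of `u` converge to `u'` in `W`.
  have h1 : ∀ s, slope (fun s => e (u s)) t s = e (slope u t s) := by
    intro s
    simp [slope]
  have h2 : ∀ K x s, slope (fun s => (u s).1 K x) t s = (slope u t s).1 K x := by
    intro K x s
    simp [slope]
  have h3 : Tendsto (fun s => e (slope u t s)) (𝓝[J \ {t}] t) (𝓝 (e u')) ↔
      Tendsto (slope u t) (𝓝[J \ {t}] t) (𝓝 u') := by
    refine ⟨fun h => ?_, fun h => (e.continuous.tendsto _).comp h⟩
    have := (e.symm.continuous.tendsto _).comp h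
    simpa [Function.comp_def] using this
  simp only [hasDerivWithinAt_iff_tendsto_slope, funext h1, funext (h2 _ _), h3,
    tendsto_subtype_rng, tendsto_pi_nhds]

/-! ## Definite bilinear forms in finite dimension -/

/-- The solution `x` of the equations `b x y = ℓ y`, for a bilinear form `b` that vanishes on the
diagonal only at zero. -/
theorem exists_linearMap_solution {P X : Type*} [AddCommGroup P] [Module ℝ P] [AddCommGroup X]
    [Module ℝ X] [FiniteDimensional ℝ X] (b : X →ₗ[ℝ] X →ₗ[ℝ] ℝ)
    (hb : ∀ x, b x x = 0 → x = 0) (l : P →ₗ[ℝ] X →ₗ[ℝ] ℝ) :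
    ∃ S : P →ₗ[ℝ] X, ∀ p x, (∀ y, b x y = l p y) ↔ x = S p := by
  have hinj : Function.Injective b := by
    refine (injective_iff_map_eq_zero b).2 fun x hx => hb x ?_
    simp [hx]
  -- Injectivity suffices because `X` and its dual have the same finite dimension.
  let e : X ≃ₗ[ℝ] (X →ₗ[ℝ] ℝ) :=
    LinearMap.linearEquivOfInjective b hinj Subspace.dual_finrank_eq.symm
  have he : ∀ x, e x = b x := fun x => rfl
  refine ⟨e.symm.toLinearMap ∘ₗ l, fun p x => ?_⟩
  rw [← LinearMap.ext_iff, ← he]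
  exact ⟨fun h => (e.eq_symm_apply).2 h, fun h => (e.eq_symm_apply).1 h⟩

/-! ## Finite-dimensionality and the inner product of alternating forms -/

section Alternating

variable {n : ℕ} {V : Type*} [NormedAddCommGroup V]

instance finiteDimensional_altForm [NormedSpace ℝ V] [FiniteDimensional ℝ V] :
    FiniteDimensional ℝ (AltForm n V) := by
  have : ∀ k : ℕ, FiniteDimensional ℝ (V [⋀^Fin k]→L[ℝ] ℝ) := fun k =>
    FiniteDimensional.of_injective
      (V₂ := MultilinearMap ℝ (fun _ : Fin k => V) ℝ)
      { toFun := fun f => f.toMultilinearMap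
        map_add' := fun _ _ => rfl
        map_smul' := fun _ _ => rfl }
      (fun f g h => ContinuousAlternatingMap.ext fun x => by
        simpa using congrArg (fun F : MultilinearMap ℝ (fun _ : Fin k => V) ℝ => F x) h)
  infer_instance

theorem interiorProd_add [NormedSpace ℝ V] (a : V) (v w : AltForm n V) :
    interiorProd a (v + w) = interiorProd a v + interiorProd a w := by
  funext k
  by_cases h : (k : ℕ) + 1 < n + 1
  · ext x
    simp [interiorProd, h]
  · simp [interiorProd, h]

theorem interiorProd_smul [NormedSpace ℝ V] (a : V) (c : ℝ) (w : AltForm n V) :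
    interiorProd a (c • w) = c • interiorProd a w := by
  funext k
  by_cases h : (k : ℕ) + 1 < n + 1
  · ext x
    simp [interiorProd, h]
  · simp [interiorProd, h]

theorem altRestrict_add [NormedSpace ℝ V] (S : Submodule ℝ V) (v w : AltForm n V) :
    altRestrict S (v + w) = altRestrict S v + altRestrict S w := rfl

theorem altRestrict_smul [NormedSpace ℝ V] (S : Submodule ℝ V) (c : ℝ) (w : AltForm n V) :
    altRestrict S (c • w) = c • altRestrict S w := rfl

variable [InnerProductSpace ℝ V] [FiniteDimensional ℝ V]

theorem altInner_comm (v w : AltForm n V) : altInner v w = altInner w v := by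
  simp only [altInner, mul_comm]

theorem altInner_self_nonneg (v : AltForm n V) : 0 ≤ altInner v v :=
  Finset.sum_nonneg fun k _ => mul_nonneg (by positivity)
    (Finset.sum_nonneg fun i _ => mul_self_nonneg _)

/-- The square norm is a positively weighted sum of squares of the values on tuples of basis
vectors, and these values determine a multilinear map. -/
theorem eq_zero_of_altInner_self {v : AltForm n V} (h : altInner v v = 0) : v = 0 := by
  rw [altInner, Finset.sum_eq_zero_iff_of_nonneg fun k _ => mul_nonneg (by positivity)
    (Finset.sum_nonneg fun i _ => mul_self_nonneg _)] at h
  funext k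
  have hk := h k (Finset.mem_univ k)
  rw [mul_eq_zero, Finset.sum_eq_zero_iff_of_nonneg fun i _ => mul_self_nonneg _] at hk
  have hk' := hk.resolve_left (by positivity)
  have hb : (v k).toMultilinearMap = 0 := by
    refine Module.Basis.ext_multilinear
      (fun _ => (stdOrthonormalBasis ℝ V).toBasis) fun i => ?_
    have := mul_self_eq_zero.1 (hk' i (Finset.mem_univ i))
    simpa using this
  ext x
  simpa using congrArg (fun F : MultilinearMap ℝ (fun _ : Fin (k : ℕ) => V) ℝ => F x) hb

variable (n V) in
/-- The inner product of alternating forms as a bilinear map. -/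
def altInnerBilin : AltForm n V →ₗ[ℝ] AltForm n V →ₗ[ℝ] ℝ :=
  LinearMap.mk₂ ℝ (altInner (n := n) (V := V))
    (fun a b c => by
      simp [altInner, add_mul, Finset.sum_add_distrib, mul_add])
    (fun r a b => by
      simp only [altInner, smul_eq_mul, Finset.mul_sum]
      exact Finset.sum_congr rfl fun k _ => Finset.sum_congr rfl fun i _ => by simp; ring)
    (fun a b c => by
      simp [altInner, Finset.sum_add_distrib, mul_add])
    (fun r a b => by
      simp only [altInner, smul_eq_mul, Finset.mul_sum]
      exact Finset.sum_congr rfl fun k _ => Finset.sum_congr rfl fun i _ => by simp; ring)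

variable (n V) in
/-- The inner product of alternating forms as a continuous bilinear map. -/
def altInnerL : AltForm n V →L[ℝ] AltForm n V →L[ℝ] ℝ :=
  LinearMap.toContinuousBilinearMap (altInnerBilin n V)

@[simp] theorem altInnerL_apply (v w : AltForm n V) : altInnerL n V v w = altInner v w := rfl

theorem continuous_altInner {X : Type*} [TopologicalSpace X] {v w : X → AltForm n V}
    (hv : Continuous v) (hw : Continuous w) : Continuous fun x => altInner (v x) (w x) := by
  simp_rw [← altInnerL_apply]
  exact ((altInnerL n V).continuous.comp hv).clm_apply hw

theorem integral_altInner_toLp {X : Type*} [MeasurableSpace X] {μ : Measure X}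
    {v w : X → AltForm n V} (hv : MemLp v 2 μ) (hw : MemLp w 2 μ) :
    ∫ x, altInner (v x) (w x) ∂μ
      = (altInnerL n V).lpPairing μ 2 2 (hv.toLp v) (hw.toLp w) := by
  rw [ContinuousLinearMap.lpPairing_eq_integral]
  refine integral_congr_ae ?_
  filter_upwards [hv.coeFn_toLp, hw.coeFn_toLp] with x h1 h2
  rw [h1, h2, altInnerL_apply]

end Alternating

/-! ## Polynomial forms -/

section Polynomial

variable {n : ℕ} {r : ℕ} {j : ℤ}

/-- The generators are values of a bilinear map on polynomials of bounded total degree and constant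
forms, two finite-dimensional spaces. -/
theorem finiteDimensional_polyForm {V : Type*} [NormedAddCommGroup V] [NormedSpace ℝ V]
    [FiniteDimensional ℝ V] (emb : V → Euc n) (r : ℕ) (j : ℤ) :
    FiniteDimensional ℝ (polyForm emb r j : Submodule ℝ (V → AltForm n V)) := by
  let φ : MvPolynomial (Fin n) ℝ →ₗ[ℝ] AltForm n V →ₗ[ℝ] (V → AltForm n V) :=
    LinearMap.mk₂ ℝ (fun p a x => MvPolynomial.eval (fun i => emb x i) p • a)
      (fun p q a => by ext x; simp [add_smul])
      (fun c p a => by ext x; simp [smul_smul])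
      (fun p a b => by ext x; simp)
      (fun c p a => by
        funext x
        simp only [Pi.smul_apply (M := fun _ : V => AltForm n V)]
        rw [smul_comm])
  have h1 : (polyForm emb r j : Submodule ℝ (V → AltForm n V)) ≤
      Submodule.map₂ φ (MvPolynomial.restrictTotalDegree (Fin n) ℝ r) (altDeg n V j) := by
    refine Submodule.span_le.2 ?_
    rintro w ⟨p, a, hp, ha, rfl⟩
    exact Submodule.apply_mem_map₂ φ ((MvPolynomial.mem_restrictTotalDegree _ _ _).2 hp) ha
  have h2 : (Submodule.map₂ φ (MvPolynomial.restrictTotalDegree (Fin n) ℝ r)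
      (altDeg n V j)).FG :=
    Submodule.FG.map₂ φ (Module.Finite.iff_fg.1 inferInstance) (Module.Finite.iff_fg.1 inferInstance)
  have := Module.Finite.iff_fg.2 h2
  exact Submodule.finiteDimensional_of_le h1

theorem polyForm_continuous_of_continuous {V : Type*} [NormedAddCommGroup V] [NormedSpace ℝ V]
    {emb : V → Euc n} (hemb : Continuous emb) {w : V → AltForm n V} (hw : w ∈ polyForm emb r j) :
    Continuous w := by
  induction hw using Submodule.span_induction with
  | mem w h =>
    obtain ⟨p, a, -, -, rfl⟩ := h
    have h1 : Continuous fun x => MvPolynomial.eval (fun i => emb x i) p :=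
      (MvPolynomial.continuous_eval p).comp (by fun_prop)
    exact h1.smul continuous_const
  | zero => exact continuous_const
  | add x y _ _ hx hy => exact hx.add hy
  | smul c x _ hx => exact hx.const_smul c

/-- Analyticity serves three ends: differentiability, continuity of the codifferential, and the
identity theorem. -/
theorem polyForm_analyticOnNhd {w : Euc n → AltForm n (Euc n)} (hw : w ∈ polyForm id r j) :
    AnalyticOnNhd ℝ w univ := by
  induction hw using Submodule.span_induction with
  | mem w h =>
    obtain ⟨p, a, -, -, rfl⟩ := h
    have h1 : AnalyticOnNhd ℝ (fun x : Euc n => MvPolynomial.eval (fun i => x i) p) univ :=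
      AnalyticOnNhd.eval_linearMap' (fun i => (EuclideanSpace.proj i : Euc n →L[ℝ] ℝ).toLinearMap) p
    exact h1.smul analyticOnNhd_const
  | zero => exact analyticOnNhd_const
  | add x y _ _ hx hy => exact hx.add hy
  | smul c x _ hx => exact (analyticOnNhd_const (v := c)).smul hx

theorem polyForm_differentiable {w : Euc n → AltForm n (Euc n)} (hw : w ∈ polyForm id r j) :
    Differentiable ℝ w := fun x => (polyForm_analyticOnNhd hw x (mem_univ x)).differentiableAt

theorem polyForm_continuous_codiff {w : Euc n → AltForm n (Euc n)} (hw : w ∈ polyForm id r j) :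
    Continuous (codiff w) := by
  have h : Continuous (fderiv ℝ w) :=
    continuousOn_univ.1 (polyForm_analyticOnNhd hw).fderiv.continuousOn
  refine (continuous_finsetSum _ fun i _ => ?_).neg
  exact (continuous_interiorProd _).comp (h.clm_apply continuous_const)

/-- This is the identity theorem for analytic functions. It makes the representation of a form on a
cell by its polynomial extension to `ℝⁿ` unique. -/
theorem polyForm_eq_zero_of_eqOn {w : Euc n → AltForm n (Euc n)} (hw : w ∈ polyForm id r j)
    {U : Set (Euc n)} (hU : IsOpen U) (hne : U.Nonempty) (h : ∀ x ∈ U, w x = 0) : w = 0 := by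
  obtain ⟨x, hx⟩ := hne
  have h1 : w =ᶠ[𝓝 x] 0 := by
    filter_upwards [hU.mem_nhds hx] with y hy using h y hy
  exact (polyForm_analyticOnNhd hw).eq_of_eventuallyEq analyticOnNhd_const h1

theorem codiff_add {v w : Euc n → AltForm n (Euc n)} (hv : Differentiable ℝ v)
    (hw : Differentiable ℝ w) : codiff (v + w) = codiff v + codiff w := by
  funext x
  simp only [codiff, Pi.add_apply (M := fun _ : Euc n => AltForm n (Euc n)),
    fderiv_add (hv x) (hw x), add_apply, interiorProd_add,
    Finset.sum_add_distrib, neg_add]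

theorem codiff_smul (c : ℝ) {w : Euc n → AltForm n (Euc n)} (hw : Differentiable ℝ w) :
    codiff (c • w) = c • codiff w := by
  funext x
  simp only [codiff, Pi.smul_apply (M := fun _ : Euc n => AltForm n (Euc n)),
    fderiv_const_smul (hw x), smul_apply, interiorProd_smul,
    ← Finset.smul_sum, smul_neg]

end Polynomial

/-! ### Families of square-integrable functions -/

/-- Families of square-integrable functions. -/
def piMemLp {ι X E : Type*} [MeasurableSpace X] [NormedAddCommGroup E] [NormedSpace ℝ E]
    (μ : ι → Measure X) : Submodule ℝ (ι → X → E) where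
  carrier := {w | ∀ K, MemLp (w K) 2 (μ K)}
  add_mem' ha hb K := (ha K).add (hb K)
  zero_mem' _ := MemLp.zero
  smul_mem' c _ ha K := (ha K).const_smul c

/-- The classes of a member of a family of square-integrable functions. -/
def piMemLpToLp {ι X E : Type*} [MeasurableSpace X] [NormedAddCommGroup E] [NormedSpace ℝ E]
    (μ : ι → Measure X) (K : ι) : (piMemLp μ : Submodule ℝ (ι → X → E)) →ₗ[ℝ] Lp E 2 (μ K) where
  toFun w := (w.2 K).toLp (w.1 K)
  map_add' _ _ := rfl
  map_smul' _ _ := rfl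

namespace PolyMesh

variable {n : ℕ} (M : PolyMesh n) {r : ℕ} {j : ℤ}

/-! ## Shortcut instances -/

scoped instance : AddCommGroup (M.W r j) := Submodule.addCommGroup _
scoped instance : Module ℝ (M.W r j) := Submodule.module _
scoped instance : AddCommMonoid (M.W r j) := Submodule.addCommMonoid _
scoped instance : AddGroup (M.W r j) := AddCommGroup.toAddGroup
scoped instance : Add (M.W r j) := AddSemigroup.toAdd
scoped instance : Sub (M.W r j) := SubNegMonoid.toSub
scoped instance : TopologicalSpace (M.W r j) := instTopologicalSpaceSubtype
set_option synthInstance.maxHeartbeats 400000 in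
scoped instance : T2Space (M.W r j) := inferInstanceAs (T2Space (Subtype _))
set_option synthInstance.maxHeartbeats 400000 in
scoped instance : IsTopologicalAddGroup (M.W r j) := Submodule.topologicalAddGroup _
set_option synthInstance.maxHeartbeats 400000 in
scoped instance : ContinuousSMul ℝ (M.W r j) := SMulMemClass.continuousSMul _
scoped instance : AddCommGroup M.SkelL2 := Pi.addCommGroup
scoped instance : Module ℝ M.SkelL2 := Pi.module _ _ _
scoped instance : AddCommGroup (M.SkelL2Deg j) := Submodule.addCommGroup _
scoped instance : Module ℝ (M.SkelL2Deg j) := Submodule.module _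
scoped instance : AddCommMonoid (M.SkelL2Deg j) := Submodule.addCommMonoid _
scoped instance : AddGroup (M.SkelL2Deg j) := AddCommGroup.toAddGroup
scoped instance : Add (M.SkelL2Deg j) := AddSemigroup.toAdd
scoped instance : Sub (M.SkelL2Deg j) := SubNegMonoid.toSub
scoped instance : AddCommGroup (M.DomL2 j) := Submodule.addCommGroup _
scoped instance : Module ℝ (M.DomL2 j) := Submodule.module _
scoped instance : AddCommMonoid (M.DomL2 j) := Submodule.addCommMonoid _
scoped instance : AddGroup (M.DomL2 j) := AddCommGroup.toAddGroup
scoped instance : Add (M.DomL2 j) := AddSemigroup.toAdd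
scoped instance : Sub (M.DomL2 j) := SubNegMonoid.toSub

/-! ## Broken square-integrable forms and polynomial forms -/

theorem isBounded_cell (K : M.Cell) : Bornology.IsBounded (M.cell K) :=
  M.isBounded_Ω.subset (M.cell_subset K)

theorem memLp_cell_of_continuous {w : Euc n → AltForm n (Euc n)} (hw : Continuous w)
    (K : M.Cell) : MemLp w 2 (volume.restrict (M.cell K)) := by
  have : IsFiniteMeasure (volume.restrict (M.cell K)) :=
    ⟨by rw [Measure.restrict_apply_univ]; exact (M.isBounded_cell K).measure_lt_top⟩
  obtain ⟨C, hC⟩ := ((M.isBounded_cell K).isCompact_closure.image hw).isBounded.exists_norm_le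
  have : SecondCountableTopologyEither (Euc n) (AltForm n (Euc n)) :=
    secondCountableTopologyEither_of_left _ _
  refine MemLp.of_bound hw.aestronglyMeasurable C ?_
  refine (ae_restrict_iff' (M.isOpen_cell K).measurableSet).2
    (Eventually.of_forall fun t ht => hC _ (mem_image_of_mem w (subset_closure ht)))

/-- Broken forms that are square integrable on each cell. -/
abbrev brokenL2 : Submodule ℝ (M.Cell → Euc n → AltForm n (Euc n)) :=
  piMemLp fun K => volume.restrict (M.cell K)

scoped instance : AddCommGroup M.brokenL2 := Submodule.addCommGroup _
scoped instance : Module ℝ M.brokenL2 := Submodule.module _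
scoped instance : AddCommMonoid M.brokenL2 := Submodule.addCommMonoid _
scoped instance : AddGroup M.brokenL2 := AddCommGroup.toAddGroup
scoped instance : Add M.brokenL2 := AddSemigroup.toAdd
scoped instance : Sub M.brokenL2 := SubNegMonoid.toSub

/-- The restriction of a broken form to a cell. -/
def brokenToLp (K : M.Cell) :
    M.brokenL2 →ₗ[ℝ] Lp (AltForm n (Euc n)) 2 (volume.restrict (M.cell K)) :=
  piMemLpToLp _ K

/-- The `L²` inner product of broken forms as a bilinear map. -/
def cellForm : M.brokenL2 →ₗ[ℝ] M.brokenL2 →ₗ[ℝ] ℝ :=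
  ∑ K, (ContinuousLinearMap.coeLM ℝ ∘ₗ
    ((altInnerL n (Euc n)).lpPairing (volume.restrict (M.cell K)) 2 2).toLinearMap).compl₁₂
      (M.brokenToLp K) (M.brokenToLp K)

theorem cellForm_apply (v w : M.brokenL2) : M.cellForm v w = M.cellPair v.1 w.1 := by
  simp only [cellForm, LinearMap.sum_apply, cellPair]
  exact Finset.sum_congr rfl fun K _ => (integral_altInner_toLp (v.2 K) (w.2 K)).symm

theorem W_le_brokenL2 : M.W r j ≤ M.brokenL2 := fun w hw K =>
  M.memLp_cell_of_continuous (W_continuous ⟨w, hw⟩ K) K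

/-- Polynomial broken forms are square integrable. -/
def incl : M.W r j →ₗ[ℝ] M.brokenL2 := Submodule.inclusion M.W_le_brokenL2

/-- The cellwise codifferential as a linear map. -/
def codiffL : M.W r j →ₗ[ℝ] M.brokenL2 where
  toFun w := ⟨M.brokenCodiff w.1, fun K =>
    M.memLp_cell_of_continuous (polyForm_continuous_codiff (w.2 K (mem_univ K))) K⟩
  map_add' v w := Subtype.ext <| funext fun K =>
    codiff_add (polyForm_differentiable (v.2 K (mem_univ K)))
      (polyForm_differentiable (w.2 K (mem_univ K)))
  map_smul' c w := Subtype.ext <| funext fun K =>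
    codiff_smul c (polyForm_differentiable (w.2 K (mem_univ K)))

/-- A form in `L²Λ^j(Ω)` as a broken form. -/
def sourceBroken (F : M.DomL2 j) : M.brokenL2 :=
  ⟨fun _ => F.1, fun K => (Lp.memLp F.1).mono_measure
    (Measure.restrict_mono (M.cell_subset K) le_rfl)⟩

instance finiteDimensional_W : FiniteDimensional ℝ (M.W r j) := by
  have := finiteDimensional_polyForm (V := Euc n) id r j
  refine FiniteDimensional.of_injective
    (V₂ := M.Cell → (polyForm id r j : Submodule ℝ (Euc n → AltForm n (Euc n))))
    { toFun := fun w K => ⟨w.1 K, w.2 K (mem_univ K)⟩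
      map_add' := fun _ _ => rfl
      map_smul' := fun _ _ => rfl } fun v w h => ?_
  exact Subtype.ext (funext fun K => congrArg Subtype.val (congrFun h K))

theorem cellPair_self_nonneg (w : M.Cell → Euc n → AltForm n (Euc n)) : 0 ≤ M.cellPair w w :=
  Finset.sum_nonneg fun _ _ => integral_nonneg fun _ => altInner_self_nonneg _

/-- Each cell integral has a nonnegative continuous integrand, so a zero integral makes the form
vanish on the open cell, and then everywhere because it is polynomial. -/
theorem eq_zero_of_cellPair_self (w : M.W r j) (h : M.cellPair w.1 w.1 = 0) : w = 0 := by
  rw [cellPair, Finset.sum_eq_zero_iff_of_nonneg fun K _ =>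
    integral_nonneg fun _ => altInner_self_nonneg _] at h
  refine Subtype.ext (funext fun K => ?_)
  refine polyForm_eq_zero_of_eqOn (w.2 K (mem_univ K)) (M.isOpen_cell K) (M.nonempty_cell K) ?_
  have hc := W_continuous w K
  have hm := M.memLp_cell_of_continuous hc K
  have hi : Integrable (fun x => altInner (w.1 K x) (w.1 K x)) (volume.restrict (M.cell K)) := by
    have := (continuous_altInner hc hc).continuousOn.integrableOn_compact
      (μ := volume) (M.isBounded_cell K).isCompact_closure
    exact this.mono_set subset_closure
  have h0 := (integral_eq_zero_iff_of_nonneg (fun _ => altInner_self_nonneg _) hi).1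
    (h K (Finset.mem_univ K))
  have h1 : EqOn (fun x => altInner (w.1 K x) (w.1 K x)) 0 (M.cell K) :=
    Measure.eqOn_open_of_ae_eq h0 (M.isOpen_cell K) (continuous_altInner hc hc).continuousOn
      continuousOn_const
  exact fun x hx => eq_zero_of_altInner_self (h1 hx)

/-- For a fixed polynomial form, the inner product with a source is continuous and linear. -/
def sourceForm (v : M.W r j) : M.DomL2 j →L[ℝ] ℝ :=
  -- The measure on a cell is kept as a restriction of the measure on `Ω`, so that passing from `Ω`
  -- to the cell is the continuous map `LpToLpRestrictCLM`.
  ∑ K, ((altInnerL n (Euc n)).lpPairing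
      ((volume.restrict M.Ω).restrict (M.cell K)) 2 2).flip
      (((M.memLp_cell_of_continuous (W_continuous v K) K).mono_measure
        (by rw [Measure.restrict_restrict (M.isOpen_cell K).measurableSet]
            exact Measure.restrict_mono inter_subset_left le_rfl)).toLp _) ∘L
    LpToLpRestrictCLM (Euc n) (AltForm n (Euc n)) ℝ (volume.restrict M.Ω) 2 (M.cell K) ∘L
    (M.DomL2 j).subtypeL

theorem sourceForm_apply (v : M.W r j) (F : M.DomL2 j) :
    M.sourceForm v F = M.cellPair (fun _ => F.1) v.1 := by
  simp only [sourceForm, sum_apply, cellPair]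
  refine Finset.sum_congr rfl fun K _ => ?_
  have hμ : (volume.restrict M.Ω).restrict (M.cell K) = volume.restrict (M.cell K) := by
    rw [Measure.restrict_restrict (M.isOpen_cell K).measurableSet,
      inter_eq_left.2 (M.cell_subset K)]
  rw [← hμ]
  simp only [ContinuousLinearMap.comp_apply, ContinuousLinearMap.flip_apply,
    ContinuousLinearMap.lpPairing_eq_integral]
  refine integral_congr_ae ?_
  filter_upwards [LpToLpRestrictCLM_coeFn (p := 2) ℝ (M.cell K) F.1, MemLp.coeFn_toLp
    ((M.memLp_cell_of_continuous (W_continuous v K) K).mono_measure hμ.le)] with x h1 h2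
  rw [h2]
  erw [h1]
  rfl

/-! ## Traces -/

/-- The `L²` inner product on the skeleton as a bilinear map. -/
def skelForm : M.SkelL2 →ₗ[ℝ] M.SkelL2 →ₗ[ℝ] ℝ :=
  ∑ K, ∑ e : M.facetsOf K, (ContinuousLinearMap.coeLM ℝ ∘ₗ
    ((altInnerL n (M.facet e).tangent).lpPairing (M.facet e).measure 2 2).toLinearMap).compl₁₂
      (LinearMap.proj e ∘ₗ LinearMap.proj K) (LinearMap.proj e ∘ₗ LinearMap.proj K)

theorem skelForm_apply (v w : M.SkelL2) : M.skelForm v w = M.skelPair v w := by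
  simp only [skelForm, LinearMap.sum_apply, skelPair]
  refine Finset.sum_congr rfl fun K _ => Finset.sum_congr rfl fun e _ => ?_
  exact ContinuousLinearMap.lpPairing_eq_integral _ _ _

theorem skelPair_comm (v w : M.SkelL2) : M.skelPair v w = M.skelPair w v := by
  simp only [skelPair, altInner_comm]

/-- The tangential trace as a linear map. -/
def tanL : M.W r j →ₗ[ℝ] M.SkelL2Deg j where
  toFun := tanTr
  map_add' _ _ := rfl
  map_smul' _ _ := rfl

theorem norOn_add {n : ℕ} (e : FlatFacet n) (ν : Euc n) (v w : Euc n → AltForm n (Euc n)) :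
    e.norOn ν (v + w) = e.norOn ν v + e.norOn ν w := by
  funext t
  simp only [FlatFacet.norOn, Pi.add_apply (M := fun _ : Euc n => AltForm n (Euc n)),
    Pi.add_apply (M := fun _ : e.tangent => AltForm n e.tangent),
    interiorProd_add, altRestrict_add]

theorem norOn_smul {n : ℕ} (e : FlatFacet n) (ν : Euc n) (c : ℝ)
    (w : Euc n → AltForm n (Euc n)) : e.norOn ν (c • w) = c • e.norOn ν w := by
  funext t
  simp only [FlatFacet.norOn, Pi.smul_apply (M := fun _ : Euc n => AltForm n (Euc n)),
    Pi.smul_apply (M := fun _ : e.tangent => AltForm n e.tangent),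
    interiorProd_smul, altRestrict_smul]

/-- The normal trace as a linear map. -/
def norL : M.W r j →ₗ[ℝ] M.SkelL2 where
  toFun := norTr
  map_add' v w := by
    funext K e
    refine Eq.trans ?_ (MemLp.toLp_add _ _)
    exact MemLp.toLp_congr _ _ (.of_eq (norOn_add _ _ (v.1 K) (w.1 K)))
  map_smul' c w := by
    funext K e
    refine Eq.trans ?_ (MemLp.toLp_const_smul c _)
    exact MemLp.toLp_congr _ _ (.of_eq (norOn_smul _ _ c (w.1 K)))

variable (r j)

/-- The space `V̂_h^{j,tan}`. -/
def vHat : Submodule ℝ (M.SkelL2Deg j) where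
  carrier := {w | M.VHat r j w}
  add_mem' {a b} ha hb := by
    refine ⟨fun K e => ?_, fun e he K K' h h' => ?_⟩
    · obtain ⟨p, hp, hp'⟩ := ha.1 K e
      obtain ⟨q, hq, hq'⟩ := hb.1 K e
      refine ⟨p + q, Submodule.add_mem _ hp hq, ?_⟩
      exact (Lp.coeFn_add (a.1 K e) (b.1 K e)).trans (hp'.add hq')
    · exact congrArg₂ (· + ·) (ha.2 e he K K' h h') (hb.2 e he K K' h h')
  zero_mem' := ⟨fun K e => ⟨0, Submodule.zero_mem _, Lp.coeFn_zero _ _ _⟩,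
    fun e he K K' h h' => rfl⟩
  smul_mem' c a ha := by
    refine ⟨fun K e => ?_, fun e he K K' h h' => ?_⟩
    · obtain ⟨p, hp, hp'⟩ := ha.1 K e
      refine ⟨c • p, Submodule.smul_mem _ c hp, ?_⟩
      exact (Lp.coeFn_smul c (a.1 K e)).trans (hp'.const_smul c)
    · exact congrArg (c • ·) (ha.2 e he K K' h h')

/-- The subspace of traces vanishing on the boundary of the domain. -/
def vRing : Submodule ℝ (M.SkelL2Deg j) where
  carrier := {w | M.VRing r j w}
  add_mem' ha hb := ⟨(M.vHat r j).add_mem ha.1 hb.1, fun K e he =>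
    (congrArg₂ (· + ·) (ha.2 K e he) (hb.2 K e he)).trans (add_zero _)⟩
  zero_mem' := ⟨(M.vHat r j).zero_mem, fun _ _ _ => rfl⟩
  smul_mem' c _ ha := ⟨(M.vHat r j).smul_mem c ha.1, fun K e he =>
    (congrArg (c • ·) (ha.2 K e he)).trans (smul_zero _)⟩

scoped instance : AddCommGroup (M.vHat r j) := Submodule.addCommGroup _
scoped instance : Module ℝ (M.vHat r j) := Submodule.module _
scoped instance : AddCommMonoid (M.vHat r j) := Submodule.addCommMonoid _
scoped instance : AddGroup (M.vHat r j) := AddCommGroup.toAddGroup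
scoped instance : Add (M.vHat r j) := AddSemigroup.toAdd
scoped instance : Sub (M.vHat r j) := SubNegMonoid.toSub
scoped instance : TopologicalSpace (M.vHat r j) := instTopologicalSpaceSubtype
set_option synthInstance.maxHeartbeats 400000 in
scoped instance : T2Space (M.vHat r j) := inferInstanceAs (T2Space (Subtype _))
set_option synthInstance.maxHeartbeats 400000 in
scoped instance : IsTopologicalAddGroup (M.vHat r j) := Submodule.topologicalAddGroup _
set_option synthInstance.maxHeartbeats 400000 in
scoped instance : ContinuousSMul ℝ (M.vHat r j) := SMulMemClass.continuousSMul _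
scoped instance : AddCommGroup (M.vRing r j) := Submodule.addCommGroup _
scoped instance : Module ℝ (M.vRing r j) := Submodule.module _
scoped instance : AddCommMonoid (M.vRing r j) := Submodule.addCommMonoid _
scoped instance : AddGroup (M.vRing r j) := AddCommGroup.toAddGroup
scoped instance : Add (M.vRing r j) := AddSemigroup.toAdd
scoped instance : Sub (M.vRing r j) := SubNegMonoid.toSub

/-- An element is determined by its components on the finitely many pairs of a cell and one of its
facets, and each component is the class of a polynomial form, hence lies in the range of a map from
a finite-dimensional space. -/
instance finiteDimensional_vHat : FiniteDimensional ℝ (M.vHat r j) := by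
  have hf : ∀ e : M.Facet, FiniteDimensional ℝ (polyForm (M.facet e).emb r j :
      Submodule ℝ ((M.facet e).tangent → AltForm n (M.facet e).tangent)) := fun e =>
    finiteDimensional_polyForm _ r j
  let T : ∀ e : M.Facet, (polyForm (M.facet e).emb r j :
      Submodule ℝ ((M.facet e).tangent → AltForm n (M.facet e).tangent)) →ₗ[ℝ]
      (M.facet e).L2 := fun e =>
    { toFun := fun p => ((M.facet e).memLp_of_continuous
        (polyForm_continuous_of_continuous (M.facet e).continuous_emb p.2)).toLp p.1
      map_add' := fun _ _ => rfl
      map_smul' := fun _ _ => rfl }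
  have hT : ∀ (w : M.vHat r j) (K : M.Cell) (e : M.facetsOf K),
      w.1.1 K e ∈ LinearMap.range (T e) := by
    intro w K e
    obtain ⟨p, hp, hp'⟩ := w.2.1 K e
    exact ⟨⟨p, hp⟩, Lp.ext ((MemLp.coeFn_toLp ((M.facet e).memLp_of_continuous
      (polyForm_continuous_of_continuous (M.facet e).continuous_emb hp))).trans hp'.symm)⟩
  refine FiniteDimensional.of_injective
    (V₂ := (K : M.Cell) → (e : M.facetsOf K) → LinearMap.range (T e))
    { toFun := fun w K e => ⟨w.1.1 K e, hT w K e⟩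
      map_add' := fun _ _ => rfl
      map_smul' := fun _ _ => rfl } fun v w h => ?_
  refine Subtype.ext (Subtype.ext (funext fun K => funext fun e => ?_))
  exact congrArg Subtype.val (congrFun (congrFun h K) e)

theorem vRing_le_vHat : M.vRing r j ≤ M.vHat r j := fun _ h => h.1

instance finiteDimensional_vRing : FiniteDimensional ℝ (M.vRing r j) :=
  Submodule.finiteDimensional_of_le (M.vRing_le_vHat r j)

variable {r j}

/-- Traces with prescribed boundary values form the affine space `g + vRing`; this moves the data to
the right-hand side of a linear problem. -/
theorem vHat_and_eqOnBdry_iff {g w : M.SkelL2Deg j} (hg : M.VHat r j g) :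
    M.VHat r j w ∧ M.EqOnBdry w g ↔ w - g ∈ M.vRing r j := by
  constructor
  · rintro ⟨h1, h2⟩
    refine ⟨(M.vHat r j).sub_mem h1 hg, fun K e he => ?_⟩
    exact (congrArg (· - g.1 K e) (h2 K e he)).trans (sub_self _)
  · rintro ⟨h1, h2⟩
    refine ⟨?_, fun K e he => sub_eq_zero.1 (h2 K e he)⟩
    have := (M.vHat r j).add_mem h1 hg
    rwa [sub_add_cancel] at this

end PolyMesh

/-! ## Two coupled systems of linear equations -/

section Systems

variable {U T V G D : Type*} [AddCommGroup U] [Module ℝ U] [AddCommGroup T] [Module ℝ T]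
  [FiniteDimensional ℝ T] [AddCommGroup V] [Module ℝ V] [FiniteDimensional ℝ V]
  [AddCommGroup G] [Module ℝ G] [AddCommGroup D] [Module ℝ D]
  {c : T →ₗ[ℝ] T →ₗ[ℝ] ℝ} {a : D →ₗ[ℝ] D →ₗ[ℝ] ℝ} {ι : V →ₗ[ℝ] D}

/-- Solvability of a system with a penalty on the jump between a trace and its numerical
counterpart. -/
theorem exists_linearMap_solution_of_neg (hc : ∀ τ, 0 ≤ c τ τ) (hc0 : ∀ τ, c τ τ = 0 → τ = 0)
    (ha : ∀ v, v ≠ 0 → a v v < 0) (hι : Function.Injective ι) (γ : G →ₗ[ℝ] D) (tan : T →ₗ[ℝ] D)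
    (l₁ : U →ₗ[ℝ] T →ₗ[ℝ] ℝ) (l₂ : U →ₗ[ℝ] V →ₗ[ℝ] ℝ) :
    ∃ S : (U × G) →ₗ[ℝ] (T × V), ∀ u g σ σ₀,
      ((∀ τ, l₁ u τ + a (ι σ₀ + γ g - tan σ) (tan τ) = - c σ τ) ∧
        ∀ w, l₂ u w - a (ι σ₀ + γ g - tan σ) (ι w) = 0) ↔ (σ, σ₀) = S (u, g) := by
  let jump : T × V →ₗ[ℝ] D := ι ∘ₗ LinearMap.snd ℝ _ _ - tan ∘ₗ LinearMap.fst ℝ _ _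
  have hj : ∀ x, jump x = ι x.2 - tan x.1 := fun _ => rfl
  -- The sum of the two equations, tested with `(τ, w)`: the penalty terms combine into `a`
  -- evaluated on the jump of the unknown and the jump of the test pair.
  let b : (T × V) →ₗ[ℝ] (T × V) →ₗ[ℝ] ℝ :=
    c.compl₁₂ (LinearMap.fst ℝ _ _) (LinearMap.fst ℝ _ _) - a.compl₁₂ jump jump
  let l : (U × G) →ₗ[ℝ] (T × V) →ₗ[ℝ] ℝ :=
    - l₁.compl₁₂ (LinearMap.fst ℝ _ _) (LinearMap.fst ℝ _ _)
    - l₂.compl₁₂ (LinearMap.fst ℝ _ _) (LinearMap.snd ℝ _ _)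
    + a.compl₁₂ (γ ∘ₗ LinearMap.snd ℝ _ _) jump
  have hb : ∀ x y, b x y = c x.1 y.1 - a (jump x) (jump y) := fun _ _ => rfl
  have hl : ∀ u g y, l (u, g) y = - l₁ u y.1 - l₂ u y.2 + a (γ g) (jump y) := fun _ _ _ => rfl
  have hdef : ∀ x, b x x = 0 → x = 0 := by
    rintro ⟨σ, σ₀⟩ h
    rw [hb] at h
    have h1 := hc σ
    have h2 : jump (σ, σ₀) = 0 := by
      by_contra hne
      have := ha _ hne
      simp only at h
      linarith
    have hσ : σ = 0 := hc0 σ (by simpa [h2] using h)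
    -- Once `σ = 0`, the vanishing jump is the numerical trace itself.
    rw [hj, hσ, map_zero, sub_zero] at h2
    exact Prod.ext hσ (hι (h2.trans (map_zero ι).symm))
  obtain ⟨S, hS⟩ := exists_linearMap_solution b hdef l
  refine ⟨S, fun u g σ σ₀ => ?_⟩
  rw [← hS]
  simp only [hb, hl, hj, map_add, map_sub, LinearMap.add_apply, LinearMap.sub_apply]
  constructor
  · rintro ⟨h1, h2⟩ ⟨τ, w⟩
    have h3 := h1 τ
    have h4 := h2 w
    simp only
    linarith
  · intro h
    refine ⟨fun τ => ?_, fun w => ?_⟩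
    · have h1 := h (τ, 0)
      simp only [map_zero] at h1
      linarith
    · have h1 := h (0, w)
      simp only [map_zero] at h1
      linarith

/-- Solvability of a system with a penalty on a numerical trace. -/
theorem exists_linearMap_solution_of_pos (hc : ∀ τ, 0 ≤ c τ τ) (hc0 : ∀ τ, c τ τ = 0 → τ = 0)
    (ha : ∀ v, v ≠ 0 → 0 < a v v) (hι : Function.Injective ι) (γ : G →ₗ[ℝ] D) (tan : U →ₗ[ℝ] D)
    (l : U →ₗ[ℝ] T →ₗ[ℝ] ℝ) (m : D →ₗ[ℝ] T →ₗ[ℝ] ℝ) :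
    ∃ S : (U × G) →ₗ[ℝ] (T × V), ∀ u g ρ u₀,
      ((∀ η, l u η + m (ι u₀ + γ g) η = - c ρ η) ∧
        ∀ w, m (ι w) ρ - a (ι u₀ + γ g - tan u) (ι w) = 0) ↔ (ρ, u₀) = S (u, g) := by
  let fst : (T × V) →ₗ[ℝ] T := LinearMap.fst ℝ _ _
  let snd : (T × V) →ₗ[ℝ] D := ι ∘ₗ LinearMap.snd ℝ _ _
  let gap : (U × G) →ₗ[ℝ] D := γ ∘ₗ LinearMap.snd ℝ _ _ - tan ∘ₗ LinearMap.fst ℝ _ _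
  -- The first equation minus the second. With this sign the two occurrences of `m` form a skew
  -- part, which disappears on the diagonal.
  let b : (T × V) →ₗ[ℝ] (T × V) →ₗ[ℝ] ℝ :=
    c.compl₁₂ fst fst + m.compl₁₂ snd fst - (m.compl₁₂ snd fst).flip + a.compl₁₂ snd snd
  let l' : (U × G) →ₗ[ℝ] (T × V) →ₗ[ℝ] ℝ :=
    - l.compl₁₂ (LinearMap.fst ℝ _ _) fst - m.compl₁₂ (γ ∘ₗ LinearMap.snd ℝ _ _) fst
    - a.compl₁₂ gap snd
  have hb : ∀ x y, b x y = c x.1 y.1 + m (ι x.2) y.1 - m (ι y.2) x.1 + a (ι x.2) (ι y.2) :=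
    fun _ _ => rfl
  have hl : ∀ u g y, l' (u, g) y = - l u y.1 - m (γ g) y.1 - a (γ g - tan u) (ι y.2) :=
    fun _ _ _ => rfl
  have hdef : ∀ x, b x x = 0 → x = 0 := by
    rintro ⟨ρ, u₀⟩ h
    simp only [hb, add_sub_cancel_right] at h
    have h1 := hc ρ
    have h2 : ι u₀ = 0 := by
      by_contra hne
      have := ha _ hne
      linarith
    exact Prod.ext (hc0 ρ (by simpa [h2] using h)) (hι (h2.trans (map_zero ι).symm))
  obtain ⟨S, hS⟩ := exists_linearMap_solution b hdef l'
  refine ⟨S, fun u g ρ u₀ => ?_⟩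
  rw [← hS]
  simp only [hb, hl, map_add, map_sub, LinearMap.add_apply, LinearMap.sub_apply]
  constructor
  · rintro ⟨h1, h2⟩ ⟨η, w⟩
    have h3 := h1 η
    have h4 := h2 w
    simp only
    linarith
  · intro h
    refine ⟨fun η => ?_, fun w => ?_⟩
    · have h1 := h (η, 0)
      simp only [map_zero, LinearMap.zero_apply] at h1
      linarith
    · have h1 := h (0, w)
      simp only [map_zero] at h1
      linarith

end Systems

namespace PolyMesh

variable {n : ℕ} {M : PolyMesh n} {r : ℕ}

/-! ## Solution of the constraints and conservativity conditions -/

variable (M r) in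
/-- The inner product of `W_h^j`. -/
def innerW (j : ℤ) : M.W r j →ₗ[ℝ] M.W r j →ₗ[ℝ] ℝ := M.cellForm.compl₁₂ M.incl M.incl

theorem innerW_apply {j : ℤ} (v w : M.W r j) : M.innerW r j v w = M.cellPair v.1 w.1 :=
  M.cellForm_apply _ _

variable (M r) in
/-- The bilinear form `(v, δw)`. -/
def codiffForm (i j : ℤ) : M.W r i →ₗ[ℝ] M.W r j →ₗ[ℝ] ℝ := M.cellForm.compl₁₂ M.incl M.codiffL

theorem codiffForm_apply {i j : ℤ} (v : M.W r i) (w : M.W r j) :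
    M.codiffForm r i j v w = M.cellPair v.1 (M.brokenCodiff w.1) :=
  M.cellForm_apply (M.incl v) (M.codiffL w)

theorem cellPair_comm (v w : M.Cell → Euc n → AltForm n (Euc n)) :
    M.cellPair v w = M.cellPair w v := by
  simp only [cellPair, altInner_comm]

variable (M) in
/-- The inner product of traces of degree `j` with arbitrary traces. -/
def traceForm (j : ℤ) : M.SkelL2Deg j →ₗ[ℝ] M.SkelL2 →ₗ[ℝ] ℝ :=
  M.skelForm ∘ₗ (M.SkelL2Deg j).subtype

theorem traceForm_apply {j : ℤ} (v : M.SkelL2Deg j) (w : M.SkelL2) :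
    M.traceForm j v w = M.skelPair v.1 w := M.skelForm_apply _ _

variable (M r) in
/-- The bilinear form `⟨v, w^nor⟩`. -/
def norForm (i j : ℤ) : M.SkelL2Deg i →ₗ[ℝ] M.W r j →ₗ[ℝ] ℝ := (M.traceForm i).compl₂ M.norL

theorem norForm_apply {i j : ℤ} (v : M.SkelL2Deg i) (w : M.W r j) :
    M.norForm r i j v w = M.skelPair v.1 (norTr w) := traceForm_apply _ _

/-- The bilinear form `⟨α v, w⟩`. -/
def penaltyForm {j : ℤ} (α : M.SkelL2Deg j →L[ℝ] M.SkelL2Deg j) :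
    M.SkelL2Deg j →ₗ[ℝ] M.SkelL2Deg j →ₗ[ℝ] ℝ :=
  (M.traceForm j).compl₁₂ α.toLinearMap (M.SkelL2Deg j).subtype

theorem penaltyForm_apply {j : ℤ} (α : M.SkelL2Deg j →L[ℝ] M.SkelL2Deg j)
    (v w : M.SkelL2Deg j) : penaltyForm α v w = M.skelPair (α v).1 w.1 := traceForm_apply _ _

theorem skelPair_sub_left (u v w : M.SkelL2) :
    M.skelPair (u - v) w = M.skelPair u w - M.skelPair v w := by
  simp only [← skelForm_apply, map_sub, LinearMap.sub_apply]

set_option maxHeartbeats 400000 in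
/-- The solution operator for the unknowns `σ` and `σ̂`. -/
theorem exists_solution_σ {k j : ℤ} (α' : M.SkelL2Deg j →L[ℝ] M.SkelL2Deg j)
    (hα' : IsNegDef α') :
    ∃ S : (M.W r k × M.vHat r j) →ₗ[ℝ] (M.W r j × M.vRing r j),
      ∀ (u : M.W r k) (g : M.vHat r j) (σ : M.W r j) (σ₀ : M.vRing r j),
      ((∀ τ : M.W r j, M.cellPair (M.brokenCodiff u.1) τ.1
          + M.skelPair (α' (σ₀.1 + g.1 - tanTr σ)).1 (tanTr τ).1 = - M.cellPair σ.1 τ.1) ∧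
        ∀ τhat : M.SkelL2Deg j, M.VRing r j τhat →
          M.skelPair (norTr u - (α' (σ₀.1 + g.1 - tanTr σ)).1) τhat.1 = 0) ↔
      (σ, σ₀) = S (u, g) := by
  have h1 : ∀ τ, 0 ≤ M.innerW r j τ τ := fun τ =>
    (innerW_apply τ τ).symm ▸ M.cellPair_self_nonneg τ.1
  have h2 : ∀ τ, M.innerW r j τ τ = 0 → τ = 0 := fun τ h =>
    M.eq_zero_of_cellPair_self τ ((innerW_apply τ τ).symm.trans h)
  have h3 : ∀ v, v ≠ 0 → penaltyForm α' v v < 0 := fun v hv =>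
    (penaltyForm_apply α' v v).symm ▸ hα' v hv
  obtain ⟨S, hS⟩ := exists_linearMap_solution_of_neg (U := M.W r k) (T := M.W r j)
    (V := M.vRing r j) (G := M.vHat r j) (D := M.SkelL2Deg j) h1 h2 h3
    (M.vRing r j).subtype_injective (M.vHat r j).subtype M.tanL (M.codiffForm r j k).flip
    ((M.norForm r j k).flip.compl₂ (M.vRing r j).subtype)
  -- In the abstract system `l₁` is `(δu, τ)` with its arguments exchanged and `l₂` is `⟨u^nor,
  -- τ̂⟩`; the symmetry of the pairings restores the stated order below.
  have hS' : ∀ u g σ σ₀, ((∀ τ, M.codiffForm r j k τ u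
      + penaltyForm α' (σ₀.1 + g.1 - tanTr σ) (tanTr τ) = - M.innerW r j σ τ) ∧
      ∀ w : M.vRing r j, M.norForm r j k w.1 u
        - penaltyForm α' (σ₀.1 + g.1 - tanTr σ) w.1 = 0) ↔ (σ, σ₀) = S (u, g) := hS
  simp only [codiffForm_apply, penaltyForm_apply, innerW_apply, norForm_apply] at hS'
  refine ⟨S, fun u g σ σ₀ => Iff.trans ?_ (hS' u g σ σ₀)⟩
  simp only [cellPair_comm (M.brokenCodiff u.1), skelPair_sub_left,
    skelPair_comm _ (norTr u)]
  exact and_congr Iff.rfl ⟨fun h w => h w.1 w.2, fun h w hw => h ⟨w, hw⟩⟩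

set_option maxHeartbeats 400000 in
/-- The solution operator for the unknowns `ρ` and `û`. -/
theorem exists_solution_ρ {k i : ℤ} (α : M.SkelL2Deg k →L[ℝ] M.SkelL2Deg k) (hα : IsPosDef α) :
    ∃ S : (M.W r k × M.vHat r k) →ₗ[ℝ] (M.W r i × M.vRing r k),
      ∀ (u : M.W r k) (g : M.vHat r k) (ρ : M.W r i) (u₀ : M.vRing r k),
      ((∀ η : M.W r i, M.cellPair u.1 (M.brokenCodiff η.1)
          + M.skelPair (u₀.1 + g.1).1 (norTr η) = - M.cellPair ρ.1 η.1) ∧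
        ∀ vhat : M.SkelL2Deg k, M.VRing r k vhat →
          M.skelPair (norTr ρ - (α (u₀.1 + g.1 - tanTr u)).1) vhat.1 = 0) ↔
      (ρ, u₀) = S (u, g) := by
  have h1 : ∀ τ, 0 ≤ M.innerW r i τ τ := fun τ =>
    (innerW_apply τ τ).symm ▸ M.cellPair_self_nonneg τ.1
  have h2 : ∀ τ, M.innerW r i τ τ = 0 → τ = 0 := fun τ h =>
    M.eq_zero_of_cellPair_self τ ((innerW_apply τ τ).symm.trans h)
  have h3 : ∀ v, v ≠ 0 → 0 < penaltyForm α v v := fun v hv =>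
    (penaltyForm_apply α v v).symm ▸ hα v hv
  obtain ⟨S, hS⟩ := exists_linearMap_solution_of_pos (U := M.W r k) (T := M.W r i)
    (V := M.vRing r k) (G := M.vHat r k) (D := M.SkelL2Deg k) h1 h2 h3
    (M.vRing r k).subtype_injective (M.vHat r k).subtype M.tanL (M.codiffForm r k i) (M.norForm r k i)
  -- The same form `⟨·, ·^nor⟩` plays the role of `m` in both equations, which is what makes the
  -- coupling skew.
  have hS' : ∀ u g ρ u₀, ((∀ η, M.codiffForm r k i u η + M.norForm r k i (u₀.1 + g.1) η
      = - M.innerW r i ρ η) ∧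
      ∀ w : M.vRing r k, M.norForm r k i w.1 ρ
        - penaltyForm α (u₀.1 + g.1 - tanTr u) w.1 = 0) ↔ (ρ, u₀) = S (u, g) := hS
  simp only [codiffForm_apply, penaltyForm_apply, innerW_apply, norForm_apply] at hS'
  refine ⟨S, fun u g ρ u₀ => Iff.trans ?_ (hS' u g ρ u₀)⟩
  simp only [skelPair_sub_left, skelPair_comm _ (norTr ρ)]
  exact and_congr Iff.rfl ⟨fun h w => h w.1 w.2, fun h w hw => h ⟨w, hw⟩⟩

end PolyMesh

/-! ## Riesz representation in finite dimension, with continuous dependence on parameters -/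

/-- Finite dimension of `P` makes `A` continuous, but the sources `F` may form an
infinite-dimensional space. Continuity of `N` is therefore checked in coordinates: pairing with a
basis identifies `W` with `ℝ^m`, and there `N f` has the components `-s f (β i)`. -/
theorem exists_continuousLinearMap_solution {W P F : Type*}
    [AddCommGroup W] [Module ℝ W] [TopologicalSpace W] [IsTopologicalAddGroup W]
    [ContinuousSMul ℝ W] [T2Space W] [FiniteDimensional ℝ W]
    [AddCommGroup P] [Module ℝ P] [TopologicalSpace P] [IsTopologicalAddGroup P]
    [ContinuousSMul ℝ P] [T2Space P] [FiniteDimensional ℝ P]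
    [AddCommGroup F] [Module ℝ F] [TopologicalSpace F]
    (b : W →ₗ[ℝ] W →ₗ[ℝ] ℝ) (hb : ∀ x, b x x = 0 → x = 0) (R : P →ₗ[ℝ] W →ₗ[ℝ] ℝ)
    (s : F →ₗ[ℝ] W →ₗ[ℝ] ℝ) (hs : ∀ v, Continuous fun f => s f v) :
    ∃ (A : P →L[ℝ] W) (N : F →L[ℝ] W), ∀ p f w,
      (∀ v, b w v = R p v - s f v) ↔ w = A p + N f := by
  obtain ⟨A, hA⟩ := exists_linearMap_solution b hb R
  obtain ⟨N, hN⟩ := exists_linearMap_solution b hb (-s)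
  let β := Module.finBasis ℝ W
  let c : W →ₗ[ℝ] (Fin (Module.finrank ℝ W) → ℝ) := LinearMap.pi fun i => b.flip (β i)
  have hc : ∀ w i, c w i = b w (β i) := fun _ _ => rfl
  have hinj : Function.Injective c := by
    refine (injective_iff_map_eq_zero c).2 fun w hw => hb w ?_
    have : b w = 0 := β.ext fun i => by
      rw [← hc, hw]
      rfl
    rw [this, LinearMap.zero_apply]
  let e : W ≃L[ℝ] (Fin (Module.finrank ℝ W) → ℝ) :=
    (LinearMap.linearEquivOfInjective c hinj (by simp)).toContinuousLinearEquiv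
  have he : ∀ w, e w = c w := fun _ => rfl
  have hNc : Continuous N := by
    have h : (fun f => e (N f)) = fun f i => - s f (β i) := by
      funext f i
      rw [he, hc]
      exact (hN f (N f)).2 rfl (β i)
    have h1 : Continuous fun f => e (N f) := by
      rw [h]
      exact continuous_pi fun i => (hs _).neg
    simpa [Function.comp_def] using e.symm.continuous.comp h1
  refine ⟨⟨A, A.continuous_of_finiteDimensional⟩, ⟨N, hNc⟩, fun p f w => ?_⟩
  have h1 := (hA p (A p)).2 rfl
  have h2 := (hN f (N f)).2 rfl
  have hsum : ∀ v, b (A p + N f) v = R p v - s f v := fun v => by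
    rw [map_add, LinearMap.add_apply, h1, h2, LinearMap.neg_apply, LinearMap.neg_apply,
      sub_eq_add_neg]
  constructor
  · intro h
    -- Two solutions have equal pairings with every test vector, in particular with their
    -- difference.
    refine sub_eq_zero.1 (hb _ ?_)
    change b (w - (A p + N f)) (w - (A p + N f)) = 0
    rw [map_sub b, LinearMap.sub_apply, h, hsum, sub_self]
  · rintro rfl
    exact hsum

/-! ## Second-order equations -/

section SecondOrder

variable {E : Type*} [NormedAddCommGroup E]
  {I : Set ℝ} {h : ℝ → E → E} {Dh : ℝ → E → E → E}

/-- The equation `x'' = h(t, x)` is treated as the first-order system `(x, y)' = (y, h(t, x))`,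
whose first component is linear in the state. -/
theorem hasDerivAt_line_secondOrder [NormedSpace ℝ E] {t : ℝ}
    (hh : ∀ x y, HasDerivAt (fun s : ℝ => h t (x + s • y)) (Dh t x y) 0) (x y : E × E) :
    HasDerivAt (fun s : ℝ => ((x + s • y).2, h t (x + s • y).1)) (y.2, Dh t x.1 y.1) 0 := by
  refine HasDerivAt.prodMk ?_ (hh x.1 y.1)
  simpa using ((hasDerivAt_id (0 : ℝ)).smul_const y.2).const_add x.2

theorem continuousOn_secondOrder
    (hc : ContinuousOn (fun q : ℝ × E × E => Dh q.1 q.2.1 q.2.2) (I ×ˢ univ)) :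
    ContinuousOn (fun q : ℝ × (E × E) × (E × E) => (q.2.2.2, Dh q.1 q.2.1.1 q.2.2.1))
      (I ×ˢ univ) := by
  refine ContinuousOn.prodMk (by fun_prop) ?_
  exact hc.comp (f := fun q : ℝ × (E × E) × (E × E) => (q.1, q.2.1.1, q.2.2.1)) (by fun_prop)
    fun q hq => ⟨hq.1, mem_univ _⟩

variable [NormedSpace ℝ E] [ProperSpace E]

theorem exists_secondOrder (hI : I.OrdConnected)
    (hhc : ContinuousOn (fun q : ℝ × E => h q.1 q.2) (I ×ˢ univ))
    (hh : ∀ t ∈ I, ∀ x y, HasDerivAt (fun s : ℝ => h t (x + s • y)) (Dh t x y) 0)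
    (hc : ContinuousOn (fun q : ℝ × E × E => Dh q.1 q.2.1 q.2.2) (I ×ˢ univ))
    {t₀ : ℝ} (ht₀ : t₀ ∈ I) (x₀ y₀ : E) :
    ∃ ε > 0, ∃ x y : ℝ → E, x t₀ = x₀ ∧ y t₀ = y₀ ∧ ∀ t ∈ I ∩ Icc (t₀ - ε) (t₀ + ε),
      HasDerivWithinAt x (y t) (I ∩ Icc (t₀ - ε) (t₀ + ε)) t ∧
      HasDerivWithinAt y (h t (x t)) (I ∩ Icc (t₀ - ε) (t₀ + ε)) t := by
  have hvc : ContinuousOn (fun q : ℝ × (E × E) => (q.2.2, h q.1 q.2.1)) (I ×ˢ univ) := by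
    refine ContinuousOn.prodMk (by fun_prop) ?_
    exact hhc.comp (f := fun q : ℝ × (E × E) => (q.1, q.2.1)) (by fun_prop)
      fun q hq => ⟨hq.1, mem_univ _⟩
  obtain ⟨ε, hε, w, hw0, hw⟩ := exists_hasDerivWithinAt_of_hasDerivAt_line
    (v := fun t q => (q.2, h t q.1)) hI hvc
    (fun t ht => hasDerivAt_line_secondOrder (hh t ht)) (continuousOn_secondOrder hc) ht₀ (x₀, y₀)
  refine ⟨ε, hε, fun t => (w t).1, fun t => (w t).2, congrArg Prod.fst hw0,
    congrArg Prod.snd hw0, fun t ht => ?_⟩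
  exact ⟨(hw t ht).fst, (hw t ht).snd⟩

theorem eqOn_secondOrder {J : Set ℝ} (hJ : J.OrdConnected)
    (hh : ∀ t ∈ J, ∀ x y, HasDerivAt (fun s : ℝ => h t (x + s • y)) (Dh t x y) 0)
    (hc : ContinuousOn (fun q : ℝ × E × E => Dh q.1 q.2.1 q.2.2) (J ×ˢ univ))
    {t₀ : ℝ} (ht₀ : t₀ ∈ J) {x₁ y₁ x₂ y₂ : ℝ → E}
    (h₁ : ∀ t ∈ J, HasDerivWithinAt x₁ (y₁ t) J t ∧ HasDerivWithinAt y₁ (h t (x₁ t)) J t)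
    (h₂ : ∀ t ∈ J, HasDerivWithinAt x₂ (y₂ t) J t ∧ HasDerivWithinAt y₂ (h t (x₂ t)) J t)
    (hx : x₁ t₀ = x₂ t₀) (hy : y₁ t₀ = y₂ t₀) {t : ℝ} (ht : t ∈ J) :
    x₁ t = x₂ t ∧ y₁ t = y₂ t := by
  have := eqOn_of_hasDerivWithinAt_of_hasDerivAt_line
    (v := fun t (q : E × E) => (q.2, h t q.1)) hJ
    (fun t ht => hasDerivAt_line_secondOrder (hh t ht)) (continuousOn_secondOrder hc) ht₀
    (y := fun t => (x₁ t, y₁ t)) (z := fun t => (x₂ t, y₂ t))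
    (fun t ht => (h₁ t ht).1.prodMk (h₁ t ht).2) (fun t ht => (h₂ t ht).1.prodMk (h₂ t ht).2)
    (Prod.ext hx hy) ht
  exact Prod.ext_iff.1 this

end SecondOrder

namespace PolyMesh

variable {n : ℕ} {M : PolyMesh n} {r : ℕ} {k : ℤ}

/-! ## Reduction to an ordinary differential equation -/

theorem vHat_eqOnBdry_add {j : ℤ} (w : M.vRing r j) (g : M.vHat r j) :
    M.VHat r j (w.1 + g.1) ∧ M.EqOnBdry (w.1 + g.1) g.1 := by
  refine (M.vHat_and_eqOnBdry_iff g.2).2 ?_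
  rw [add_sub_cancel_right]
  exact w.2

theorem exists_eq_add_of_eqOnBdry {j : ℤ} {w : M.SkelL2Deg j} {g : M.vHat r j}
    (h : M.VHat r j w) (h' : M.EqOnBdry w g.1) : ∃ w₀ : M.vRing r j, w = w₀.1 + g.1 :=
  ⟨⟨_, (M.vHat_and_eqOnBdry_iff g.2).1 ⟨h, h'⟩⟩, (sub_add_cancel w g.1).symm⟩

/-- The unknowns with given parts and given boundary data. -/
def mkAux (s : M.W r (k - 1) × M.vRing r (k - 1)) (t : M.W r (k + 1) × M.vRing r k)
    (gσ : M.vHat r (k - 1)) (gu : M.vHat r k) : M.Aux r k :=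
  ⟨s.1, t.1, s.2.1 + gσ.1, t.2.1 + gu.1⟩

/-- With `u` given, the equations for `(σ, σ̂)` and for `(ρ, û)` share no unknown, so the two
solution operators can be applied separately after the lifts of the boundary data are split off. -/
theorem solves_iff {α' : M.SkelL2Deg (k - 1) →L[ℝ] M.SkelL2Deg (k - 1)}
    {α : M.SkelL2Deg k →L[ℝ] M.SkelL2Deg k} {u : M.W r k} {gσ : M.vHat r (k - 1)}
    {gu : M.vHat r k} {s : M.W r (k - 1) × M.vRing r (k - 1)}
    {t : M.W r (k + 1) × M.vRing r k}
    (hS : ∀ (σ : M.W r (k - 1)) (σ₀ : M.vRing r (k - 1)),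
      ((∀ τ : M.W r (k - 1), M.cellPair (M.brokenCodiff u.1) τ.1
          + M.skelPair (α' (σ₀.1 + gσ.1 - tanTr σ)).1 (tanTr τ).1 = - M.cellPair σ.1 τ.1) ∧
        ∀ τhat : M.SkelL2Deg (k - 1), M.VRing r (k - 1) τhat →
          M.skelPair (norTr u - (α' (σ₀.1 + gσ.1 - tanTr σ)).1) τhat.1 = 0) ↔ (σ, σ₀) = s)
    (hT : ∀ (ρ : M.W r (k + 1)) (u₀ : M.vRing r k),
      ((∀ η : M.W r (k + 1), M.cellPair u.1 (M.brokenCodiff η.1)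
          + M.skelPair (u₀.1 + gu.1).1 (norTr η) = - M.cellPair ρ.1 η.1) ∧
        ∀ vhat : M.SkelL2Deg k, M.VRing r k vhat →
          M.skelPair (norTr ρ - (α (u₀.1 + gu.1 - tanTr u)).1) vhat.1 = 0) ↔ (ρ, u₀) = t)
    (z : M.Aux r k) : z.Solves α' α gσ.1 gu.1 u ↔ z = mkAux s t gσ gu := by
  constructor
  · intro h
    obtain ⟨σ, ρ, σhat, uhat⟩ := z
    obtain ⟨σ₀, rfl⟩ := exists_eq_add_of_eqOnBdry h.σhat_mem h.σhat_bdry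
    obtain ⟨u₀, rfl⟩ := exists_eq_add_of_eqOnBdry h.uhat_mem h.uhat_bdry
    obtain rfl := (hS σ σ₀).1 ⟨h.constraint_σ, h.conserv_σ⟩
    obtain rfl := (hT ρ u₀).1 ⟨h.constraint_ρ, h.conserv_u⟩
    rfl
  · rintro rfl
    obtain ⟨σ, σ₀⟩ := s
    obtain ⟨ρ, u₀⟩ := t
    have h1 := (hS σ σ₀).2 rfl
    have h2 := (hT ρ u₀).2 rfl
    have h3 := vHat_eqOnBdry_add σ₀ gσ
    have h4 := vHat_eqOnBdry_add u₀ gu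
    exact ⟨h3.1, h4.1, h3.2, h4.2, h1.1, h2.1, h1.2, h2.2⟩

/-- The solution operators of the constraints and conservativity conditions. -/
theorem exists_solves_iff {α' : M.SkelL2Deg (k - 1) →L[ℝ] M.SkelL2Deg (k - 1)}
    {α : M.SkelL2Deg k →L[ℝ] M.SkelL2Deg k} (hα' : IsNegDef α') (hα : IsPosDef α) :
    ∃ (S : (M.W r k × M.vHat r (k - 1)) →ₗ[ℝ] (M.W r (k - 1) × M.vRing r (k - 1)))
      (T : (M.W r k × M.vHat r k) →ₗ[ℝ] (M.W r (k + 1) × M.vRing r k)),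
      ∀ (u : M.W r k) (gσ : M.vHat r (k - 1)) (gu : M.vHat r k) (z : M.Aux r k),
        z.Solves α' α gσ.1 gu.1 u ↔ z = mkAux (S (u, gσ)) (T (u, gu)) gσ gu :=
  (exists_solution_σ (r := r) (k := k) α' hα').imp fun _ hS =>
    (exists_solution_ρ (r := r) (i := k + 1) α hα).imp fun _ hT u gσ gu =>
      solves_iff (hS u gσ) (hT u gu)

/-- Isolating `(ṗ, v)` and exchanging the arguments of `(δρ, v)` puts the equation in the form of a
Riesz representation problem. -/
theorem dynEq_mkAux_iff {α : M.SkelL2Deg k →L[ℝ] M.SkelL2Deg k} {F : M.DomL2 k}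
    {u p : M.W r k} {s : M.W r (k - 1) × M.vRing r (k - 1)} {t : M.W r (k + 1) × M.vRing r k}
    {gσ : M.vHat r (k - 1)} {gu : M.vHat r k} {u' p' : M.W r k} :
    DynEq α F u p (mkAux s t gσ gu) u' p' ↔
      (∀ v : M.W r k, M.cellPair u'.1 v.1 = M.cellPair p.1 v.1) ∧
      ∀ v : M.W r k, M.cellPair p'.1 v.1 = M.cellPair s.1.1 (M.brokenCodiff v.1)
        + M.cellPair v.1 (M.brokenCodiff t.1.1) + M.skelPair (s.2.1 + gσ.1).1 (norTr v)
        + M.skelPair (α (t.2.1 + gu.1 - tanTr u)).1 (tanTr v).1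
        - M.cellPair (fun _ => F.1) v.1 := by
  obtain ⟨σ, σ₀⟩ := s
  obtain ⟨ρ, u₀⟩ := t
  have key : ∀ a b c d e f c' : ℝ, c = c' → (-a + b + c + d + e = f ↔ a = b + c' + d + e - f) := by
    rintro a b c d e f _ rfl
    constructor <;> intro h <;> linarith
  exact ⟨fun h => ⟨h.u_eq, fun v => (key _ _ _ _ _ _ _ (cellPair_comm _ _)).1 (h.p_eq v)⟩,
    fun h => ⟨h.1, fun v => (key _ _ _ _ _ _ _ (cellPair_comm _ _)).2 (h.2 v)⟩⟩

/-- The functional `v ↦ (F, v)` on `W_h^k`. -/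
def sourceFunctional (F : M.DomL2 k) : M.W r k →ₗ[ℝ] ℝ := M.cellForm (M.sourceBroken F) ∘ₗ M.incl

theorem sourceFunctional_apply (F : M.DomL2 k) (v : M.W r k) :
    sourceFunctional F v = M.sourceForm v F :=
  (M.cellForm_apply _ _).trans (M.sourceForm_apply v F).symm

/-- The inner product with a source as a bilinear map. -/
def sourceBilin : M.DomL2 k →ₗ[ℝ] M.W r k →ₗ[ℝ] ℝ where
  toFun := sourceFunctional
  -- The representative of `F + G` is the sum of the representatives only almost everywhere, so
  -- `sourceBroken` need not be additive; linearity is read off from `sourceForm`, which acts on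
  -- classes.
  map_add' F G := LinearMap.ext fun v => by
    rw [LinearMap.add_apply, sourceFunctional_apply, sourceFunctional_apply,
      sourceFunctional_apply]
    exact (M.sourceForm v).map_add F G
  map_smul' c F := LinearMap.ext fun v => by
    rw [LinearMap.smul_apply, sourceFunctional_apply, sourceFunctional_apply]
    exact (M.sourceForm v).map_smul c F

set_option maxHeartbeats 2000000 in
/-- The constraints have a unique solution, and the dynamical equations determine the velocities
as continuous affine functions of the state, the boundary data and the source. -/
theorem exists_velocity {α' : M.SkelL2Deg (k - 1) →L[ℝ] M.SkelL2Deg (k - 1)}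
    {α : M.SkelL2Deg k →L[ℝ] M.SkelL2Deg k} (hα' : IsNegDef α') (hα : IsPosDef α) :
    (∀ (u : M.W r k) (gσ : M.vHat r (k - 1)) (gu : M.vHat r k),
      ∃! z : M.Aux r k, z.Solves α' α gσ.1 gu.1 u) ∧
    ∃ (A : (M.W r k × M.vHat r (k - 1) × M.vHat r k) →L[ℝ] M.W r k)
      (N : M.DomL2 k →L[ℝ] M.W r k),
      ∀ (u p : M.W r k) (gσ : M.vHat r (k - 1)) (gu : M.vHat r k) (z : M.Aux r k)
        (F : M.DomL2 k) (u' p' : M.W r k), z.Solves α' α gσ.1 gu.1 u →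
        (DynEq α F u p z u' p' ↔ u' = p ∧ p' = A (u, gσ, gu) + N F) := by
  obtain ⟨S, T, hST⟩ := exists_solves_iff (r := r) hα' hα
  refine ⟨fun u gσ gu => ⟨_, (hST u gσ gu _).2 rfl, fun z hz => (hST u gσ gu z).1 hz⟩, ?_⟩
  let P := M.W r k × M.vHat r (k - 1) × M.vHat r k
  let pu : P →ₗ[ℝ] M.W r k := LinearMap.fst ℝ _ _
  let pσ : P →ₗ[ℝ] M.vHat r (k - 1) := LinearMap.fst ℝ _ _ ∘ₗ LinearMap.snd ℝ _ _
  let pg : P →ₗ[ℝ] M.vHat r k := LinearMap.snd ℝ _ _ ∘ₗ LinearMap.snd ℝ _ _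
  let S' : P →ₗ[ℝ] (M.W r (k - 1) × M.vRing r (k - 1)) := S ∘ₗ pu.prod pσ
  let T' : P →ₗ[ℝ] (M.W r (k + 1) × M.vRing r k) := T ∘ₗ pu.prod pg
  let σhat : P →ₗ[ℝ] M.SkelL2Deg (k - 1) :=
    (M.vRing r (k - 1)).subtype ∘ₗ LinearMap.snd ℝ _ _ ∘ₗ S' + (M.vHat r (k - 1)).subtype ∘ₗ pσ
  let gap : P →ₗ[ℝ] M.SkelL2Deg k :=
    (M.vRing r k).subtype ∘ₗ LinearMap.snd ℝ _ _ ∘ₗ T' + (M.vHat r k).subtype ∘ₗ pg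
      - M.tanL ∘ₗ pu
  -- All terms of the second dynamical equation except those with `ṗ` and the source, as a
  -- functional of `(u, gσ, gu)`; the momentum `p` does not enter.
  let R : P →ₗ[ℝ] M.W r k →ₗ[ℝ] ℝ :=
    M.codiffForm r (k - 1) k ∘ₗ LinearMap.fst ℝ _ _ ∘ₗ S'
    + (M.codiffForm r k (k + 1)).flip ∘ₗ LinearMap.fst ℝ _ _ ∘ₗ T'
    + M.norForm r (k - 1) k ∘ₗ σhat + (penaltyForm α).compl₂ M.tanL ∘ₗ gap
  have hR : ∀ u gσ gu v, R (u, gσ, gu) v = M.codiffForm r (k - 1) k (S (u, gσ)).1 v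
      + M.codiffForm r k (k + 1) v (T (u, gu)).1
      + M.norForm r (k - 1) k ((S (u, gσ)).2.1 + gσ.1) v
      + penaltyForm α ((T (u, gu)).2.1 + gu.1 - tanTr u) (tanTr v) := fun _ _ _ _ => rfl
  clear_value R
  have hb : ∀ w, M.innerW r k w w = 0 → w = 0 := fun w h =>
    M.eq_zero_of_cellPair_self w ((innerW_apply w w).symm.trans h)
  obtain ⟨A, N, hAN⟩ := exists_continuousLinearMap_solution (W := M.W r k)
    (P := M.W r k × M.vHat r (k - 1) × M.vHat r k) (F := M.DomL2 k) (M.innerW r k) hb R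
    sourceBilin (fun v => (M.sourceForm v).continuous.congr fun F =>
      (sourceFunctional_apply F v).symm)
  have hs : ∀ (F : M.DomL2 k) (v : M.W r k), sourceBilin F v = M.cellPair (fun _ => F.1) v.1 :=
    fun F v => M.cellForm_apply _ _
  refine ⟨A, N, fun u p gσ gu z F u' p' hz => ?_⟩
  obtain rfl := (hST u gσ gu z).1 hz
  rw [← hAN, dynEq_mkAux_iff]
  simp only [hR, hs, innerW_apply, codiffForm_apply, norForm_apply, penaltyForm_apply]
  -- The first equation gives `u' = p` by testing with `u' - p`.
  refine and_congr_left fun _ => ⟨fun h => sub_eq_zero.1 (hb _ ?_), fun h _ => by rw [h]⟩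
  have := h (u' - p)
  rw [← innerW_apply, ← innerW_apply] at this
  rw [map_sub (M.innerW r k), LinearMap.sub_apply, this, sub_self]

end PolyMesh

/-! ## Second-order equations in a finite-dimensional space of functions -/

section FunctionSpace

variable {X ι F G D : Type*} [NormedAddCommGroup F] [NormedSpace ℝ F]
  {W : Submodule ℝ (X → ι → F)}
  [AddCommGroup G] [Module ℝ G] [TopologicalSpace G]
  [NormedAddCommGroup D] [NormedSpace ℝ D]
  (A : (W × G) →L[ℝ] W) (N : D →L[ℝ] W) {I : Set ℝ} {f : ℝ → W → D} {Df : ℝ → W → W → D}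
  {g : ℝ → G}

/-- At a fixed time the data `g t` is constant along the line, so the affine part contributes only
`A (y, 0)`; the rest is the chain rule for the linear map `N`. -/
theorem hasDerivAt_line_coord {E : Type*} [NormedAddCommGroup E] [NormedSpace ℝ E]
    (e : W ≃L[ℝ] E) {t : ℝ} (hf : ∀ u v, HasDerivAt (fun s : ℝ => f t (u + s • v)) (Df t u v) 0)
    (x y : E) :
    HasDerivAt (fun s : ℝ => e (A (e.symm (x + s • y), g t) + N (f t (e.symm (x + s • y)))))
      (e (A (e.symm y, 0)) + e (N (Df t (e.symm x) (e.symm y)))) 0 := by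
  have h1 := ((e : W →L[ℝ] E) ∘L N).hasFDerivAt.comp_hasDerivAt (0 : ℝ)
    (hf (e.symm x) (e.symm y))
  have h2 : HasDerivAt (fun s : ℝ => e (A (e.symm x, g t)) + s • e (A (e.symm y, 0)))
      (e (A (e.symm y, 0))) 0 := by
    simpa using ((hasDerivAt_id (0 : ℝ)).smul_const (e (A (e.symm y, 0)))).const_add
      (e (A (e.symm x, g t)))
  refine (h2.add h1).congr_of_eventuallyEq (.of_eq (funext fun s => ?_))
  have h3 : ((e.symm x + s • e.symm y, g t) : W × G) = (e.symm x, g t) + s • (e.symm y, 0) := by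
    simp
  simp only [Pi.add_apply, Function.comp, ContinuousLinearMap.comp_apply,
    ContinuousLinearEquiv.coe_coe, map_add, map_smul, h3]

/-- The function space `W` carries only a vector space topology. A basis transports the system to
`ℝ^m`, where the ODE results apply, and pointwise derivatives correspond to derivatives of the
coordinates. -/
theorem exists_solution_functionSpace [FiniteDimensional ℝ W] (hI : I.OrdConnected) (hg : ContinuousOn g I)
    (hfc : ContinuousOn (fun q : ℝ × W => f q.1 q.2) (I ×ˢ univ))
    (hf : ∀ t ∈ I, ∀ u v, HasDerivAt (fun s : ℝ => f t (u + s • v)) (Df t u v) 0)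
    (hDf : ContinuousOn (fun q : ℝ × W × W => Df q.1 q.2.1 q.2.2) (I ×ˢ univ))
    {t₀ : ℝ} (ht₀ : t₀ ∈ I) (u₀ p₀ : W) :
    (∃ ε > 0, ∃ u p : ℝ → W, u t₀ = u₀ ∧ p t₀ = p₀ ∧ ∀ t ∈ I ∩ Icc (t₀ - ε) (t₀ + ε),
      (∀ K x, HasDerivWithinAt (fun s => (u s).1 K x) ((p t).1 K x)
        (I ∩ Icc (t₀ - ε) (t₀ + ε)) t) ∧
      ∀ K x, HasDerivWithinAt (fun s => (p s).1 K x) ((A (u t, g t) + N (f t (u t))).1 K x)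
        (I ∩ Icc (t₀ - ε) (t₀ + ε)) t) ∧
    ∀ J ⊆ I, J.OrdConnected → t₀ ∈ J → ∀ u₁ p₁ u₂ p₂ : ℝ → W,
      (∀ t ∈ J, (∀ K x, HasDerivWithinAt (fun s => (u₁ s).1 K x) ((p₁ t).1 K x) J t) ∧
        ∀ K x, HasDerivWithinAt (fun s => (p₁ s).1 K x)
          ((A (u₁ t, g t) + N (f t (u₁ t))).1 K x) J t) →
      (∀ t ∈ J, (∀ K x, HasDerivWithinAt (fun s => (u₂ s).1 K x) ((p₂ t).1 K x) J t) ∧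
        ∀ K x, HasDerivWithinAt (fun s => (p₂ s).1 K x)
          ((A (u₂ t, g t) + N (f t (u₂ t))).1 K x) J t) →
      u₁ t₀ = u₂ t₀ → p₁ t₀ = p₂ t₀ → ∀ t ∈ J, u₁ t = u₂ t ∧ p₁ t = p₂ t := by
  let e : W ≃L[ℝ] (Fin (Module.finrank ℝ W) → ℝ) :=
    (Module.finBasis ℝ W).equivFun.toContinuousLinearEquiv
  have hhc : ContinuousOn (fun q : ℝ × (Fin (Module.finrank ℝ W) → ℝ) =>
      e (A (e.symm q.2, g q.1) + N (f q.1 (e.symm q.2)))) (I ×ˢ univ) := by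
    refine e.continuous.comp_continuousOn (ContinuousOn.add ?_ ?_)
    · refine A.continuous.comp_continuousOn (ContinuousOn.prodMk
        (e.symm.continuous.comp continuous_snd).continuousOn ?_)
      exact hg.comp continuousOn_fst fun q hq => hq.1
    · refine N.continuous.comp_continuousOn ?_
      exact hfc.comp (f := fun q : ℝ × (Fin (Module.finrank ℝ W) → ℝ) => (q.1, e.symm q.2))
        (continuous_fst.prodMk (e.symm.continuous.comp continuous_snd)).continuousOn fun q hq => ⟨hq.1, mem_univ _⟩
  have hc : ContinuousOn (fun q : ℝ × (Fin (Module.finrank ℝ W) → ℝ) ×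
      (Fin (Module.finrank ℝ W) → ℝ) =>
      e (A (e.symm q.2.2, 0)) + e (N (Df q.1 (e.symm q.2.1) (e.symm q.2.2)))) (I ×ˢ univ) := by
    refine ContinuousOn.add ?_ ((e.continuous.comp N.continuous).comp_continuousOn ?_)
    · refine (e.continuous.comp A.continuous).comp_continuousOn ?_
      exact ContinuousOn.prodMk (e.symm.continuous.comp
        (continuous_snd.comp continuous_snd)).continuousOn continuousOn_const
    · exact hDf.comp (f := fun q : ℝ × (Fin (Module.finrank ℝ W) → ℝ) ×
        (Fin (Module.finrank ℝ W) → ℝ) => (q.1, e.symm q.2.1, e.symm q.2.2))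
        (continuous_fst.prodMk ((e.symm.continuous.comp (continuous_fst.comp continuous_snd)).prodMk
          (e.symm.continuous.comp (continuous_snd.comp continuous_snd)))).continuousOn fun q hq => ⟨hq.1, mem_univ _⟩
  constructor
  · obtain ⟨ε, hε, x, y, hx0, hy0, hxy⟩ := exists_secondOrder
      (h := fun t x => e (A (e.symm x, g t) + N (f t (e.symm x))))
      (Dh := fun t x y => e (A (e.symm y, 0)) + e (N (Df t (e.symm x) (e.symm y)))) hI hhc
      (fun t ht => hasDerivAt_line_coord A N e (hf t ht)) hc ht₀ (e u₀) (e p₀)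
    refine ⟨ε, hε, fun t => e.symm (x t), fun t => e.symm (y t), by simp [hx0], by simp [hy0],
      fun t ht => ⟨?_, ?_⟩⟩
    · refine (hasDerivWithinAt_comp_equiv_iff e _ _ _ t).1 ?_
      simpa using (hxy t ht).1
    · refine (hasDerivWithinAt_comp_equiv_iff e _ _ _ t).1 ?_
      simpa using (hxy t ht).2
  · intro J hJI hJ ht₀' u₁ p₁ u₂ p₂ h₁ h₂ hu hp t ht
    have hd : ∀ u p : ℝ → W,
        (∀ t ∈ J, (∀ K x, HasDerivWithinAt (fun s => (u s).1 K x) ((p t).1 K x) J t) ∧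
        ∀ K x, HasDerivWithinAt (fun s => (p s).1 K x)
          ((A (u t, g t) + N (f t (u t))).1 K x) J t) → ∀ t ∈ J,
        HasDerivWithinAt (fun s => e (u s)) (e (p t)) J t ∧
        HasDerivWithinAt (fun s => e (p s))
          (e (A (e.symm (e (u t)), g t) + N (f t (e.symm (e (u t)))))) J t := by
      intro u p h t ht
      rw [e.symm_apply_apply]
      exact ⟨(hasDerivWithinAt_comp_equiv_iff e _ _ _ t).2 (h t ht).1,
        (hasDerivWithinAt_comp_equiv_iff e _ _ _ t).2 (h t ht).2⟩
    have := eqOn_secondOrder hJ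
      (h := fun t x => e (A (e.symm x, g t) + N (f t (e.symm x))))
      (Dh := fun t x y => e (A (e.symm y, 0)) + e (N (Df t (e.symm x) (e.symm y))))
      (fun t ht => hasDerivAt_line_coord A N e (hf t (hJI ht)))
      (hc.mono (prod_mono hJI le_rfl)) ht₀' (hd u₁ p₁ h₁) (hd u₂ p₂ h₂)
      (congrArg e hu) (congrArg e hp) ht
    exact ⟨e.injective this.1, e.injective this.2⟩

end FunctionSpace

/-! ### Boundary data as curves, and assembly of the theorem -/

namespace PolyMesh

variable {n : ℕ} {M : PolyMesh n} {r : ℕ}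

/-- Boundary data as a curve in the space of numerical traces. -/
theorem exists_vHat_curve {j : ℤ} {I : Set ℝ} {g : ℝ → M.SkelL2Deg j}
    (hg : ∀ t ∈ I, M.VHat r j (g t)) :
    ∃ g' : ℝ → M.vHat r j, (∀ t ∈ I, (g' t).1 = g t) ∧ (ContinuousOn g I → ContinuousOn g' I) := by
  classical
  let g' : ℝ → M.vHat r j := fun t => if h : M.VHat r j (g t) then ⟨g t, h⟩ else 0
  have h : ∀ t ∈ I, (g' t).1 = g t := fun t ht => by
    simp only [g', dif_pos (hg t ht)]
  exact ⟨g', h, fun hc => IsInducing.subtypeVal.continuousOn_iff.2 (hc.congr h)⟩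

end PolyMesh

end

set_option maxHeartbeats 1000000 in
theorem mainTheorem9 (n r k : ℕ) (M : PolyMesh n)
    (α' : M.SkelL2Deg ((k : ℤ) - 1) →L[ℝ] M.SkelL2Deg ((k : ℤ) - 1))
    (α : M.SkelL2Deg (k : ℤ) →L[ℝ] M.SkelL2Deg (k : ℤ))
    (hα'_symm : PolyMesh.IsSymm α') (hα_symm : PolyMesh.IsSymm α)
    (hα' : PolyMesh.IsNegDef α') (hα : PolyMesh.IsPosDef α) :
    -- unique solvability of the constraints and conservativity conditions
    (∀ (gσ : M.SkelL2Deg ((k : ℤ) - 1)) (gu : M.SkelL2Deg (k : ℤ)),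
      M.VHat r ((k : ℤ) - 1) gσ → M.VHat r (k : ℤ) gu →
      ∀ u : M.W r (k : ℤ), ∃! z : M.Aux r (k : ℤ), z.Solves α' α gσ gu u) ∧
    -- the velocities are functions of time and of the state
    (∀ (I : Set ℝ) (f : ℝ → M.W r (k : ℤ) → M.DomL2 (k : ℤ))
      (gσ : ℝ → M.SkelL2Deg ((k : ℤ) - 1)) (gu : ℝ → M.SkelL2Deg (k : ℤ)),
      (∀ t ∈ I, M.VHat r ((k : ℤ) - 1) (gσ t)) → (∀ t ∈ I, M.VHat r (k : ℤ) (gu t)) →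
      ∀ t ∈ I, ∀ u p : M.W r (k : ℤ), ∃! v : M.W r (k : ℤ) × M.W r (k : ℤ),
        ∃ z : M.Aux r (k : ℤ), z.Solves α' α (gσ t) (gu t) u ∧
          PolyMesh.DynEq α (f t u) u p z v.1 v.2) ∧
    -- the initial value problem is uniquely solvable
    (∀ (I : Set ℝ) (f : ℝ → M.W r (k : ℤ) → M.DomL2 (k : ℤ))
      (gσ : ℝ → M.SkelL2Deg ((k : ℤ) - 1)) (gu : ℝ → M.SkelL2Deg (k : ℤ)),
      I.OrdConnected →
      (∀ t ∈ I, M.VHat r ((k : ℤ) - 1) (gσ t)) → (∀ t ∈ I, M.VHat r (k : ℤ) (gu t)) →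
      ContinuousOn gσ I → ContinuousOn gu I → PolyMesh.IsC1Source I f →
      ∀ t₀ ∈ I, ∀ u₀ p₀ : M.W r (k : ℤ),
        (∃ ε > 0, ∃ (u p : ℝ → M.W r (k : ℤ)) (z : ℝ → M.Aux r (k : ℤ)),
          u t₀ = u₀ ∧ p t₀ = p₀ ∧
          PolyMesh.IsSolution α' α f gσ gu (I ∩ Icc (t₀ - ε) (t₀ + ε)) u p z) ∧
        ∀ J : Set ℝ, J ⊆ I → J.OrdConnected → t₀ ∈ J →
          ∀ (u₁ p₁ u₂ p₂ : ℝ → M.W r (k : ℤ)) (z₁ z₂ : ℝ → M.Aux r (k : ℤ)),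
            PolyMesh.IsSolution α' α f gσ gu J u₁ p₁ z₁ →
            PolyMesh.IsSolution α' α f gσ gu J u₂ p₂ z₂ →
            u₁ t₀ = u₀ → p₁ t₀ = p₀ → u₂ t₀ = u₀ → p₂ t₀ = p₀ →
            ∀ t ∈ J, u₁ t = u₂ t ∧ p₁ t = p₂ t ∧ z₁ t = z₂ t) := by
  obtain ⟨hsolve, A, N, hAN⟩ := PolyMesh.exists_velocity (r := r) hα' hα
  refine ⟨fun gσ gu hσ hu u => hsolve u ⟨gσ, hσ⟩ ⟨gu, hu⟩, ?_, ?_⟩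
  · intro I f gσ gu hσ hu t ht u p
    obtain ⟨z, hz, hzu⟩ := hsolve u ⟨gσ t, hσ t ht⟩ ⟨gu t, hu t ht⟩
    refine ⟨(p, A (u, ⟨gσ t, hσ t ht⟩, ⟨gu t, hu t ht⟩) + N (f t u)),
      ⟨z, hz, (hAN _ _ _ _ z _ _ _ hz).2 ⟨rfl, rfl⟩⟩, ?_⟩
    rintro ⟨u', p'⟩ ⟨z', hz', h⟩
    -- The velocity formula is the same for every `z'` that solves the constraints.
    have h' := (hAN _ _ ⟨gσ t, hσ t ht⟩ ⟨gu t, hu t ht⟩ z' _ _ _ hz').1 h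
    exact Prod.ext h'.1 h'.2
  · intro I f gσ gu hI hσ hu hσc huc hf t₀ ht₀ u₀ p₀
    obtain ⟨hfc, Df, hDf, hDfc⟩ := hf
    obtain ⟨gσ', hgσ, hgσc⟩ := PolyMesh.exists_vHat_curve hσ
    obtain ⟨gu', hgu, hguc⟩ := PolyMesh.exists_vHat_curve hu
    open scoped PolyMesh in
    obtain ⟨hex, huniq⟩ := exists_solution_functionSpace A N (g := fun t => (gσ' t, gu' t)) hI
      ((hgσc hσc).prodMk (hguc huc)) hfc hDf hDfc ht₀ u₀ p₀
    constructor
    · obtain ⟨ε, hε, u, p, hu0, hp0, h⟩ := hex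
      -- The curves `gσ'` and `gu'` lie in the trace spaces for every real `t`, so the auxiliary
      -- unknowns can be chosen at all times.
      choose z hz _ using fun t => hsolve (u t) (gσ' t) (gu' t)
      refine ⟨ε, hε, u, p, z, hu0, hp0, fun t ht => ?_, fun t ht => ?_⟩
      · rw [← hgσ t ht.1, ← hgu t ht.1]
        exact hz t
      · exact ⟨_, _, (h t ht).1, (h t ht).2, (hAN _ _ _ _ _ _ _ _ (hz t)).2 ⟨rfl, rfl⟩⟩
    · intro J hJI hJ ht₀J u₁ p₁ u₂ p₂ z₁ z₂ h₁ h₂ hu₁ hp₁ hu₂ hp₂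
      have hd : ∀ (u p : ℝ → M.W r (k : ℤ)) (z : ℝ → M.Aux r (k : ℤ)),
          PolyMesh.IsSolution α' α f gσ gu J u p z → ∀ t ∈ J,
          (z t).Solves α' α (gσ' t).1 (gu' t).1 (u t) ∧
          (∀ K x, HasDerivWithinAt (fun s => (u s).1 K x) ((p t).1 K x) J t) ∧
          ∀ K x, HasDerivWithinAt (fun s => (p s).1 K x)
            ((A (u t, gσ' t, gu' t) + N (f t (u t))).1 K x) J t := by
        intro u p z h t ht
        have hz := h.constraints t ht
        rw [← hgσ t (hJI ht), ← hgu t (hJI ht)] at hz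
        obtain ⟨u', p', hu', hp', hdyn⟩ := h.dynamics t ht
        have hv := (hAN (u t) (p t) (gσ' t) (gu' t) (z t) (f t (u t)) u' p' hz).1 hdyn
        exact ⟨hz, fun K x => hv.1 ▸ hu' K x, fun K x => hv.2 ▸ hp' K x⟩
      intro t ht
      obtain ⟨hut, hpt⟩ := huniq J hJI hJ ht₀J u₁ p₁ u₂ p₂ (fun t ht => (hd _ _ _ h₁ t ht).2)
        (fun t ht => (hd _ _ _ h₂ t ht).2) (hu₁.trans hu₂.symm) (hp₁.trans hp₂.symm) t ht
      have hz₁ := (hd _ _ _ h₁ t ht).1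
      have hz₂ := (hd _ _ _ h₂ t ht).1
      -- Since the states agree, `z₁ t` and `z₂ t` solve the same constraints, whose solution is
      -- unique.
      rw [← hut] at hz₂
      exact ⟨hut, hpt, (hsolve _ _ _).unique hz₁ hz₂⟩
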